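/- Let $X$ be a (finite-dimensional) real analytic manifold, let $\varepsilon>0$, and let $(\varphi_t)_{t\in(-\varepsilon,\varepsilon)}$ be a real analytic family of real analytic automorphisms of $X$ (each $\varphi_t$ is a real analytic diffeomorphism of $X$, and $(t,x)\mapsto\varphi_t(x)$ is real analytic on $(-\varepsilon,\varepsilon)\times X$) with $\varphi_0=\mathrm{id}_X$. Let $\xi_t=\xi(t):=\dot\varphi_t\circ\varphi_t^{-1}$, a real analytic time-dependent vector field, write $\xi_t^{(k)}:=\frac{d^k\xi_t}{dt^k}$, and let $\xi_k:=\frac1{k!}\xi_0^{(k)}$, so that $\xi(t)=\sum_{k\ge0}\xi_kt^k$ near $t=0$. For $k\ge1$ write $\lambda\vDash k$ if $\lambda=(\lambda_1,\dots,\lambda_{l_\lambda})$ is a composition of $k$, i.e. a finite sequence of positive integers with sum $k$, and put $|\lambda|=k$, $|\lambda|_j=\lambda_1+\dots+\lambda_j$ and $$C_\lambda=\frac{|\lambda|!}{\prod_{j=1}^{l_\lambda}\bigl[(\lambda_j-1)!\,|\lambda|_j\bigr]}.$$ Let $L_\eta$ denote the Lie derivative of tensor fields along a vector field $\eta$; products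 of such operators are composed from left to right in the order of the index $j$. Let $p,q\ge0$ and let $\alpha$ be a real analytic section of $(T_X^*)^{\otimes p}\otimes T_X^{\otimes q}$. Then: 1. For each $x\in X$ the maps $t\mapsto\xi_t(x)$ and $t\mapsto(\varphi_t^*\alpha)(x)$ are real analytic on $(-\varepsilon,\varepsilon)$, and every $x_0\in X$ has a neighbourhood $U$ and a $\delta>0$ such that $\xi_t(x)=\sum_{k\ge0}t^k\xi_k(x)$ and $$(\varphi_t^*\alpha)(x)=\alpha(x)+\sum_{k\ge1}t^k\sum_{\lambda\vDash k}\Bigl(\prod_{j=1}^{l_\lambda}L_{|\lambda|_j^{-1}\,\xi_{\lambda_j-1}}\alpha\Bigr)(x)\qquad(x\in U,\ |t|<\delta),$$ with convergent series. 2. For all $k\ge1$, all $t\in(-\varepsilon,\varepsilon)$ and, pointwise, at every $x\in X$, $$\frac{d^k}{dt^k}\,\varphi_t^*\alpha=\sum_{\lambda\vDash k}C_\lambda\;\varphi_t^*\Bigl(\prod_{j=1}^{l_\lambda}L_{\xi_t^{(\lambda_j-1)}}\Bigr)\alpha .$$ -/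

import Mathlib

set_option maxSynthPendingDepth 3

open scoped Manifold ContDiff Topology

noncomputable section

namespace LieExpansion

/-- Tensors in `(V*)^{⊗p} ⊗ V^{⊗q}` over a finite-dimensional real vector space `V`, as multilinear
maps in `p` vectors and `q` covectors (first the vectors, then the covectors). -/
abbrev Tensor (p q : ℕ) (V : Type*) [AddCommGroup V] [Module ℝ V] [TopologicalSpace V]
    [IsTopologicalAddGroup V] [ContinuousSMul ℝ V] : Type _ :=
  ContinuousMultilinearMap ℝ (fun _ : Fin p => V)
    (ContinuousMultilinearMap ℝ (fun _ : Fin q => V →L[ℝ] ℝ) ℝ)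

section Linear

variable {p q : ℕ} {V W : Type*}
  [AddCommGroup V] [Module ℝ V] [TopologicalSpace V] [IsTopologicalAddGroup V] [ContinuousSMul ℝ V]
  [AddCommGroup W] [Module ℝ W] [TopologicalSpace W] [IsTopologicalAddGroup W] [ContinuousSMul ℝ W]

/-- The pull-back of a tensor on `W` by a linear isomorphism `f : V → W`: vectors are pushed forward
by `f`, covectors by `η ↦ η ∘ f⁻¹`. -/
def Tensor.pullback (f : V →L[ℝ] W) (A : Tensor p q W) : Tensor p q V :=
  (ContinuousMultilinearMap.compContinuousLinearMapL (𝕜 := ℝ) (F := ℝ)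
      (fun _ : Fin q => ContinuousLinearMap.precomp ℝ f.inverse)).compContinuousMultilinearMap
    (A.compContinuousLinearMap (fun _ => f))

theorem Tensor.pullback_apply (f : V →L[ℝ] W) (A : Tensor p q W) (v : Fin p → V)
    (η : Fin q → (V →L[ℝ] ℝ)) :
    Tensor.pullback f A v η = A (fun i => f (v i)) (fun j => (η j).comp f.inverse) := rfl

/-- The derivation action of an endomorphism `D` on tensors:
`(D · A)(v, η) = ∑ᵢ A(v₁, …, D vᵢ, …, v_p, η) - ∑ⱼ A(v, η₁, …, ηⱼ ∘ D, …, η_q)`. -/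
def Tensor.derivation (D : V →L[ℝ] V) (A : Tensor p q V) : Tensor p q V :=
  (∑ i : Fin p, A.compContinuousLinearMap
      (Function.update (fun _ : Fin p => ContinuousLinearMap.id ℝ V) i D)) -
    ∑ j : Fin q, (ContinuousMultilinearMap.compContinuousLinearMapL (𝕜 := ℝ) (F := ℝ)
      (Function.update (fun _ : Fin q => ContinuousLinearMap.id ℝ (V →L[ℝ] ℝ)) j
        (ContinuousLinearMap.precomp ℝ D))).compContinuousMultilinearMap A

theorem Tensor.derivation_apply (D : V →L[ℝ] V) (A : Tensor p q V) (v : Fin p → V)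
    (η : Fin q → (V →L[ℝ] ℝ)) :
    Tensor.derivation D A v η =
      (∑ i : Fin p, A (Function.update v i (D (v i))) η) -
        ∑ j : Fin q, A v (Function.update η j ((η j).comp D)) := by
  have key : ∀ {n : ℕ} {U : Type _} [AddCommGroup U] [Module ℝ U] [TopologicalSpace U]
      (T : U →L[ℝ] U) (u : Fin n → U) (i : Fin n),
      (fun k => (Function.update (fun _ : Fin n => ContinuousLinearMap.id ℝ U) i T) k (u k)) =
        Function.update u i (T (u i)) := by
    intro n U _ _ _ T u i
    funext k
    by_cases h : k = i
    · subst h; simp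
    · simp [h]
  simp only [Tensor.derivation, sub_apply, sum_apply,
    ContinuousMultilinearMap.compContinuousLinearMap_apply,
    ContinuousLinearMap.compContinuousMultilinearMap_coe, Function.comp_apply]
  congr 1
  · refine Finset.sum_congr rfl fun i _ => ?_
    rw [key]
  · refine Finset.sum_congr rfl fun j _ => ?_
    exact congrArg (A v) (key (ContinuousLinearMap.precomp ℝ D) η j)

end Linear

section Flat

variable {p q : ℕ} {E : Type*} [NormedAddCommGroup E] [NormedSpace ℝ E]

/-- The Lie derivative of a tensor field `B` on an open subset of a vector space along `ξ`, in
coordinates: `L_ξ B = ∂_ξ B + (dξ) · B`. For functions this is the derivative along `ξ`, for vector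
fields (`p = 0`, `q = 1`) the bracket `[ξ, B]`, for covector fields `∂_ξ B + B ∘ dξ`. -/
def flatLieDeriv (ξ : E → E) (B : E → Tensor p q E) (y : E) : Tensor p q E :=
  fderiv ℝ B y (ξ y) + Tensor.derivation (fderiv ℝ ξ y) (B y)

end Flat

section Manifold

variable {p q : ℕ}
  {E : Type*} [NormedAddCommGroup E] [NormedSpace ℝ E]
  {X : Type*} [TopologicalSpace X] [ChartedSpace E X]
  {Y : Type*} [TopologicalSpace Y] [ChartedSpace E Y]

variable (E X) in
/-- Vector fields on `X`, without regularity. -/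
abbrev VectorField : Type _ := (x : X) → TangentSpace 𝓘(ℝ, E) x

variable (p q E X) in
/-- Sections of `(T*X)^{⊗p} ⊗ (TX)^{⊗q}`, without regularity. -/
abbrev TensorField : Type _ := (x : X) → Tensor p q (TangentSpace 𝓘(ℝ, E) x)

/-- The pull-back `ψ^* A` of a tensor field by a (local) diffeomorphism `ψ`. -/
def pullback (ψ : Y → X) (A : TensorField p q E X) : TensorField p q E Y :=
  fun y => Tensor.pullback (mfderiv 𝓘(ℝ, E) 𝓘(ℝ, E) ψ y) (A (ψ y))

/-- The coordinate expression of a tensor field in the preferred chart at `x₀`. -/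
def tensorInChart (x₀ : X) (A : TensorField p q E X) : E → Tensor p q E :=
  pullback (E := E) (extChartAt 𝓘(ℝ, E) x₀).symm A

/-- The coordinate expression of a vector field in the preferred chart at `x₀`. -/
def vectorInChart (x₀ : X) (ξ : VectorField E X) : E → E :=
  VectorField.mpullback 𝓘(ℝ, E) 𝓘(ℝ, E) (extChartAt 𝓘(ℝ, E) x₀).symm ξ

/-- A tensor field is real analytic if its coordinate expressions are. -/
def IsAnalytic (A : TensorField p q E X) : Prop :=
  ∀ x₀ : X, AnalyticOnNhd ℝ (tensorInChart x₀ A) (extChartAt 𝓘(ℝ, E) x₀).target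

/-- The Lie derivative `L_ξ A` of a tensor field `A` on the manifold `X`. -/
def lieDeriv (ξ : VectorField E X) (A : TensorField p q E X) : TensorField p q E X :=
  fun x => pullback (Y := X) (X := E) (extChartAt 𝓘(ℝ, E) x)
    (flatLieDeriv (vectorInChart x ξ) (tensorInChart x A)) x

/-- The product of Lie derivatives `L_{ξ₁} L_{ξ₂} ⋯ L_{ξ_l}`, composed from left to right. -/
def multiLieDeriv (ξs : List (VectorField E X)) (A : TensorField p q E X) : TensorField p q E X :=
  ξs.foldr lieDeriv A

/-- The time-dependent vector field `ξ_t = φ̇_t ∘ φ_t⁻¹` of a family of automorphisms. -/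
def velocity (φ : ℝ → X ≃ₘ^ω⟮𝓘(ℝ, E), 𝓘(ℝ, E)⟯ X) (t : ℝ) : VectorField E X :=
  fun x => (φ t).apply_symm_apply x ▸
    (mfderiv 𝓘(ℝ, ℝ) 𝓘(ℝ, E) (fun s => φ s ((φ t).symm x)) t (1 : ℝ) :
      TangentSpace 𝓘(ℝ, E) (φ t ((φ t).symm x)))

theorem velocity_apply (φ : ℝ → X ≃ₘ^ω⟮𝓘(ℝ, E), 𝓘(ℝ, E)⟯ X) (t : ℝ) (x : X) :
    velocity φ t (φ t x) = mfderiv 𝓘(ℝ, ℝ) 𝓘(ℝ, E) (fun s => φ s x) t (1 : ℝ) := by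
  have key : ∀ (y : X) (h : y = x) (h' : φ t y = φ t x),
      (h' ▸ (mfderiv 𝓘(ℝ, ℝ) 𝓘(ℝ, E) (fun s => φ s y) t (1 : ℝ) :
        TangentSpace 𝓘(ℝ, E) (φ t y)) : TangentSpace 𝓘(ℝ, E) (φ t x)) =
      mfderiv 𝓘(ℝ, ℝ) 𝓘(ℝ, E) (fun s => φ s x) t (1 : ℝ) := by
    intro y h h'
    subst h
    rfl
  exact key _ ((φ t).symm_apply_apply x) _

/-- The time derivative `ξ_t^{(k)} = d^k ξ_t / dt^k`; at each `x` this is the derivative of a curve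
in the fixed vector space `T_x X`, whose underlying topological vector space is `E`. -/
def timeDeriv (ξ : ℝ → VectorField E X) (k : ℕ) (t : ℝ) : VectorField E X :=
  fun x => iteratedDeriv (F := E) k (fun s => ξ s x) t

/-- The Taylor coefficient `ξ_k` in `ξ_t = ∑ ξ_k t^k`. -/
def timeCoeff (ξ : ℝ → VectorField E X) (k : ℕ) : VectorField E X :=
  fun x => ((k.factorial : ℝ)⁻¹) • timeDeriv ξ k 0 x

end Manifold

/-- The coefficient `C_λ = |λ|! / ∏ⱼ (λⱼ - 1)! |λ|ⱼ` with `|λ|ⱼ = λ₁ + ⋯ + λⱼ`. -/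
def compCoeff {k : ℕ} (c : Composition k) : ℝ :=
  (k.factorial : ℝ) /
    ∏ j : Fin c.length, (((c.blocksFun j - 1).factorial : ℝ) * (c.sizeUpTo (j + 1) : ℝ))

end LieExpansion

end

/-!
For a time-dependent tensor field `α_t` one has
`d/dt (φ_t^* α_t) = φ_t^* ((∂_t + L_{ξ_t}) α_t)`, so that the `k`-th time derivative of `φ_t^* α`
is `φ_t^* ((∂_t + L_{ξ_t})^k α)`. Since `[∂_t, L_{ξ^{(m)}}] = L_{ξ^{(m+1)}}` and `∂_t α = 0`, the
power can be expanded in products of the operators `L_{ξ^{(m)}}`. This expansion is pure algebra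
(`pow_add_apply_eq_compositionSum`): removing the last part of a composition, the coefficients
`C_λ` satisfy a recursion with binomial coefficients (`listCoeff_append_singleton`,
`compositionSum_succ`), and `∂_t + L_{ξ_t}` respects this recursion by Pascal's rule
(`add_mul_compositionSum`).

The differential identities are proved on open subsets of `ℝ × E`, where `E` is the model space:
`fderiv_tensorPullback_apply` differentiates a pull-back `A^* T` in `A` and `T`, from which both the
formula along a flow (`timePartial_flowPullback`) and the naturality of the Lie derivative under a
change of coordinates (`flatLieDeriv_pullback`) follow, and `timePartial_spaceLie` is the
commutator. Naturality shows that the Lie derivative on the manifold, which is defined pointwise by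
the preferred chart at each point, can be computed in one chart near a given point
(`tensorInChart_lieDeriv`), so that iterated Lie derivatives can be computed there too
(`tensorInChart_multiLieDeriv`), and the formula for the derivatives results
(`iteratedDeriv_tensorAt_pullback`).

All of this needs the velocity field to be jointly analytic in time and space. In coordinates it is
the time derivative of the flow composed with the local inverse of `(t, y) ↦ (t, φ_t y)`, which is
analytic by the inverse function theorem (`analyticAt_vectorInChart_velocity`).

The expansions at `t = 0` are Taylor expansions of jointly analytic functions of `(t, y)`; a radius
of convergence that is locally uniform in `y` comes from recentering the joint power series
(`eventually_hasSum_iteratedDeriv`). The coefficients are identified by the formula for the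
derivatives at `t = 0`; normalizing the vector fields by `1 / (|λ|_j (λ_j - 1)!)` turns the factor
`C_λ / k!` into `1` (`multiLieDeriv_timeCoeff`).
-/

noncomputable section

namespace LieExpansion

/-! ### Compositions and iterated commutators -/

/-- A composition of `k + 1` is a composition of `k - m` followed by a last block `m + 1`. -/
theorem sum_composition_succ {M : Type*} [AddCommMonoid M] (k : ℕ) (g : List ℕ → M) :
    ∑ c : Composition (k + 1), g c.blocks =
      ∑ m ∈ Finset.range (k + 1), ∑ c : Composition (k - m), g (c.blocks ++ [m + 1]) := by
  symm
  rw [Finset.sum_sigma']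
  refine Finset.sum_bij
    (fun x hx => ⟨x.2.blocks ++ [x.1 + 1], ?_, ?_⟩) (fun _ _ => Finset.mem_univ _) ?_ ?_
    (fun _ _ => rfl)
  · intro i hi
    rcases List.mem_append.1 hi with h | h
    · exact x.2.blocks_pos h
    · simp at h
      omega
  · have : x.1 < k + 1 := by simpa using hx
    simp only [List.sum_append, x.2.blocks_sum, List.sum_singleton]
    omega
  · rintro ⟨m, c⟩ _ ⟨m', c'⟩ _ h
    obtain ⟨h1, h2⟩ := List.append_inj' (congrArg Composition.blocks h) rfl
    have : m = m' := by simpa using h2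
    subst this
    have : c = c' := Composition.ext h1
    subst this
    rfl
  · intro c _
    have hne : c.blocks ≠ [] := by
      rw [Ne, Composition.blocks_eq_nil]; omega
    have hdec := List.dropLast_append_getLast hne
    have hpos := c.blocks_pos (List.getLast_mem hne)
    have hsum := c.blocks_sum
    rw [← hdec, List.sum_append, List.sum_singleton] at hsum
    refine ⟨⟨c.blocks.getLast hne - 1, ⟨c.blocks.dropLast, ?_, by omega⟩⟩, ?_, ?_⟩
    · intro i hi
      exact c.blocks_pos (List.mem_of_mem_dropLast hi)
    · simp; omega
    · apply Composition.ext
      simp only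
      rw [Nat.sub_add_cancel hpos, hdec]

/-- The coefficient `C_λ` for a composition given as a list. -/
def listCoeff (l : List ℕ) : ℝ :=
  (l.sum.factorial : ℝ) /
    ∏ j ∈ Finset.range l.length, (((l.getD j 0 - 1).factorial : ℝ) * ((l.take (j + 1)).sum : ℝ))

theorem compCoeff_eq_listCoeff {k : ℕ} (c : Composition k) :
    compCoeff c = listCoeff c.blocks := by
  rw [compCoeff, listCoeff, c.blocks_sum, Finset.prod_range]
  congr 1
  refine Finset.prod_congr rfl fun j _ => ?_
  have hj : (j : ℕ) < c.blocks.length := j.2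
  rw [List.getD_eq_getElem _ _ hj]
  rfl

theorem ofFn_blocksFun_map {k : ℕ} (c : Composition k) {Z : Type*} (F : ℕ → Z) :
    (List.ofFn fun j : Fin c.length => F (c.blocksFun j)) = c.blocks.map F := by
  rw [← c.ofFn_blocksFun, List.map_ofFn]
  rfl

theorem compCoeff_eq_mul_prod {k : ℕ} (c : Composition k) :
    ∏ j : Fin c.length, ((c.sizeUpTo (j + 1) : ℝ)⁻¹ * ((c.blocksFun j - 1).factorial : ℝ)⁻¹) =
      (k.factorial : ℝ)⁻¹ * compCoeff c := by
  have hk : (k.factorial : ℝ) ≠ 0 := by exact_mod_cast k.factorial_ne_zero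
  rw [compCoeff, ← mul_div_assoc, inv_mul_cancel₀ hk, one_div, ← Finset.prod_inv_distrib]
  refine Finset.prod_congr rfl fun j _ => ?_
  rw [mul_inv, mul_comm]

/-- Appending a last part multiplies `C_λ` by a binomial coefficient. -/
theorem listCoeff_append_singleton (l : List ℕ) (m : ℕ) :
    listCoeff (l ++ [m + 1]) = ((l.sum + m).choose m : ℝ) * listCoeff l := by
  have h1 : ∏ j ∈ Finset.range l.length,
      ((((l ++ [m + 1]).getD j 0 - 1).factorial : ℝ) * (((l ++ [m + 1]).take (j + 1)).sum : ℝ)) =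
      ∏ j ∈ Finset.range l.length,
        (((l.getD j 0 - 1).factorial : ℝ) * ((l.take (j + 1)).sum : ℝ)) := by
    refine Finset.prod_congr rfl fun j hj => ?_
    have hj := Finset.mem_range.1 hj
    rw [List.getD_append _ _ _ _ hj, List.take_append_of_le_length (by omega)]
  have h2 : (l ++ [m + 1]).getD l.length 0 = m + 1 := by
    rw [List.getD_append_right _ _ _ _ le_rfl]; simp
  have h3 : (l ++ [m + 1]).take (l.length + 1) = l ++ [m + 1] := by
    rw [List.take_of_length_le (by simp)]
  have h4 := Nat.add_choose_mul_factorial_mul_factorial l.sum m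
  rw [listCoeff, List.length_append, List.length_singleton, Finset.prod_range_succ, h1, h2, h3,
    listCoeff, mul_div_assoc', mul_comm (Finset.prod _ _), ← div_div]
  congr 1
  rw [List.sum_append, List.sum_singleton, ← add_assoc, Nat.factorial_succ, Nat.add_sub_cancel,
    ← h4]
  have : (m.factorial : ℝ) ≠ 0 := by exact_mod_cast m.factorial_ne_zero
  have h5 : ((l.sum + m + 1 : ℕ) : ℝ) ≠ 0 := by positivity
  rw [div_eq_iff (by positivity)]
  push_cast
  ring

section CompositionSum

variable {R : Type*} [Ring R] [Algebra ℝ R]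

/-- The noncommutative polynomial `∑_{λ ⊨ k} C_λ ∏ⱼ L_{λⱼ - 1}`. -/
def compositionSum (L : ℕ → R) (k : ℕ) : R :=
  ∑ c : Composition k, compCoeff c • (c.blocks.map fun m => L (m - 1)).prod

theorem compositionSum_zero (L : ℕ → R) : compositionSum L 0 = 1 := by
  rw [compositionSum, Finset.sum_congr rfl (g := fun _ => (1 : R))]
  · simp [composition_card]
  · intro c _
    have : c.blocks = [] := by rw [Composition.blocks_eq_nil]
    rw [compCoeff_eq_listCoeff, this]
    simp [listCoeff]

theorem compositionSum_succ (L : ℕ → R) (k : ℕ) :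
    compositionSum L (k + 1) =
      ∑ m ∈ Finset.range (k + 1), (k.choose m : ℝ) • (compositionSum L (k - m) * L m) := by
  simp only [compositionSum, compCoeff_eq_listCoeff]
  rw [sum_composition_succ k (fun l => listCoeff l • (l.map fun m => L (m - 1)).prod)]
  refine Finset.sum_congr rfl fun m hm => ?_
  have hm : m ≤ k := by have := Finset.mem_range.1 hm; omega
  rw [Finset.sum_mul, Finset.smul_sum]
  refine Finset.sum_congr rfl fun c _ => ?_
  rw [listCoeff_append_singleton, c.blocks_sum, Nat.sub_add_cancel hm]
  simp [mul_smul]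

/-- If `D L_m = L_m D + L_{m+1}`, then `D + L_0` acts on the polynomials `compositionSum L k`
by raising `k`, up to a term that vanishes on the kernel of `D`. -/
theorem add_mul_compositionSum (L : ℕ → R) (D : R) (h : ∀ m, D * L m = L m * D + L (m + 1))
    (k : ℕ) :
    (D + L 0) * compositionSum L k = compositionSum L (k + 1) + compositionSum L k * D := by
  induction k using Nat.strong_induction_on with
  | _ k ih =>
    cases k with
    | zero => simp [compositionSum_succ, compositionSum_zero, add_comm]
    | succ k =>
      have key : ∀ m ∈ Finset.range (k + 1),
          (D + L 0) * ((k.choose m : ℝ) • (compositionSum L (k - m) * L m)) =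
          (k.choose m : ℝ) • (compositionSum L (k + 1 - m) * L m) +
          (k.choose m : ℝ) • (compositionSum L (k - m) * L (m + 1)) +
          (k.choose m : ℝ) • (compositionSum L (k - m) * L m) * D := by
        intro m hm
        have hm' := Finset.mem_range.1 hm
        have hk : k + 1 - m = k - m + 1 := by omega
        rw [mul_smul_comm, ← mul_assoc, ih (k - m) (by omega), hk, smul_mul_assoc, ← smul_add,
          ← smul_add, add_mul, mul_assoc (compositionSum L (k - m)) D, h]
        simp only [mul_add, mul_assoc]
        congr 1
        abel
      conv_lhs => rw [compositionSum_succ, Finset.mul_sum, Finset.sum_congr rfl key,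
        Finset.sum_add_distrib, Finset.sum_add_distrib, ← Finset.sum_mul, ← compositionSum_succ]
      congr 1
      -- Pascal's rule
      rw [compositionSum_succ L (k + 1), Finset.sum_range_succ' _ (k + 1)]
      simp only [Nat.choose_succ_succ, Nat.cast_add, add_smul, Finset.sum_add_distrib,
        Nat.add_sub_add_right]
      rw [Finset.sum_range_succ (fun m => ((k.choose (m + 1) : ℕ) : ℝ) • _) k,
        Finset.sum_range_succ' (fun m => ((k.choose m : ℕ) : ℝ) • _) k]
      simp
      abel

/-- The higher product rule `(D + L_0)^k = ∑_{λ ⊨ k} C_λ ∏ⱼ L_{λⱼ - 1}` modulo the left ideal of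
`D`, when `L_{m+1}` is the commutator of `D` and `L_m`. -/
theorem pow_add_apply_eq_compositionSum {M : Type*} [AddCommGroup M] [Module ℝ M]
    (L : ℕ → Module.End ℝ M) (D : Module.End ℝ M) (h : ∀ m, D * L m = L m * D + L (m + 1))
    (b : M) (hb : D b = 0) (k : ℕ) :
    ((D + L 0) ^ k) b = compositionSum L k b := by
  induction k with
  | zero => simp [compositionSum_zero]
  | succ k ih =>
    have := congrArg (fun T : Module.End ℝ M => T b) (add_mul_compositionSum L D h k)
    simp only [Module.End.mul_apply, LinearMap.add_apply _ _ b, hb, map_zero, add_zero] at this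
    rw [pow_succ', Module.End.mul_apply, ih, this]

end CompositionSum

/-! ### Tensors on a vector space -/

section TensorAlgebra

variable {p q : ℕ} {V W U : Type*}
  [AddCommGroup V] [Module ℝ V] [TopologicalSpace V] [IsTopologicalAddGroup V] [ContinuousSMul ℝ V]
  [AddCommGroup W] [Module ℝ W] [TopologicalSpace W] [IsTopologicalAddGroup W] [ContinuousSMul ℝ W]
  [AddCommGroup U] [Module ℝ U] [TopologicalSpace U] [IsTopologicalAddGroup U] [ContinuousSMul ℝ U]

theorem Tensor.ext_apply {A B : Tensor p q V} (h : ∀ v η, A v η = B v η) : A = B :=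
  ContinuousMultilinearMap.ext fun v => ContinuousMultilinearMap.ext fun η => h v η

@[simp]
theorem Tensor.pullback_id (A : Tensor p q V) :
    Tensor.pullback (ContinuousLinearMap.id ℝ V) A = A := by
  refine Tensor.ext_apply fun v η => ?_
  simp [Tensor.pullback_apply]

theorem Tensor.pullback_add (f : V →L[ℝ] W) (A B : Tensor p q W) :
    Tensor.pullback f (A + B) = Tensor.pullback f A + Tensor.pullback f B :=
  Tensor.ext_apply fun _ _ => rfl

theorem Tensor.pullback_smul (f : V →L[ℝ] W) (c : ℝ) (A : Tensor p q W) :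
    Tensor.pullback f (c • A) = c • Tensor.pullback f A :=
  Tensor.ext_apply fun _ _ => rfl

theorem Tensor.pullback_comp {f : V →L[ℝ] W} {g : U →L[ℝ] V} (hg : g.IsInvertible)
    (A : Tensor p q W) :
    Tensor.pullback (f ∘L g) A = Tensor.pullback g (Tensor.pullback f A) := by
  refine Tensor.ext_apply fun v η => ?_
  simp only [Tensor.pullback_apply, hg.inverse_comp_of_right]
  rfl

/-- The derivation action is natural: if `f D₁ = D₂ f` then `f^*` intertwines `D₁` and `D₂`. -/
theorem Tensor.derivation_pullback {f : V →L[ℝ] W} (hf : f.IsInvertible) {D₁ : V →L[ℝ] V}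
    {D₂ : W →L[ℝ] W} (h : f ∘L D₁ = D₂ ∘L f) (A : Tensor p q W) :
    Tensor.derivation D₁ (Tensor.pullback f A) = Tensor.pullback f (Tensor.derivation D₂ A) := by
  have h' : D₁ ∘L f.inverse = f.inverse ∘L D₂ := by
    ext w
    apply hf.injective
    have := congrArg (fun T : V →L[ℝ] W => T (f.inverse w)) h
    simp only [ContinuousLinearMap.comp_apply, hf.self_apply_inverse] at this ⊢
    exact this
  refine Tensor.ext_apply fun v η => ?_
  simp only [Tensor.derivation_apply, Tensor.pullback_apply]
  congr 1
  · refine Finset.sum_congr rfl fun i _ => ?_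
    congr 2
    funext k
    by_cases hk : k = i
    · subst hk
      simpa using congrArg (fun T : V →L[ℝ] W => T (v k)) h
    · simp [hk]
  · refine Finset.sum_congr rfl fun j _ => ?_
    congr 1
    funext k
    by_cases hk : k = j
    · subst hk
      simp only [Function.update_self]
      rw [ContinuousLinearMap.comp_assoc, h', ContinuousLinearMap.comp_assoc]
    · simp [hk]

theorem Tensor.derivation_add_left (D₁ D₂ : V →L[ℝ] V) (A : Tensor p q V) :
    Tensor.derivation (D₁ + D₂) A = Tensor.derivation D₁ A + Tensor.derivation D₂ A := by
  refine Tensor.ext_apply fun v η => ?_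
  simp only [Tensor.derivation_apply, add_apply, ContinuousMultilinearMap.map_update_add,
    ContinuousLinearMap.comp_add, Finset.sum_add_distrib]
  ring

theorem Tensor.derivation_smul_left (c : ℝ) (D : V →L[ℝ] V) (A : Tensor p q V) :
    Tensor.derivation (c • D) A = c • Tensor.derivation D A := by
  refine Tensor.ext_apply fun v η => ?_
  simp only [Tensor.derivation_apply, smul_apply, ContinuousMultilinearMap.map_update_smul,
    ContinuousLinearMap.comp_smul, smul_eq_mul, Finset.mul_sum, mul_sub]

theorem Tensor.derivation_add_right (D : V →L[ℝ] V) (A B : Tensor p q V) :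
    Tensor.derivation D (A + B) = Tensor.derivation D A + Tensor.derivation D B := by
  refine Tensor.ext_apply fun v η => ?_
  simp only [Tensor.derivation_apply, add_apply, Finset.sum_add_distrib]
  ring

theorem Tensor.derivation_smul_right (c : ℝ) (D : V →L[ℝ] V) (A : Tensor p q V) :
    Tensor.derivation D (c • A) = c • Tensor.derivation D A := by
  refine Tensor.ext_apply fun v η => ?_
  simp only [Tensor.derivation_apply, smul_apply, smul_eq_mul, Finset.mul_sum, mul_sub]

end TensorAlgebra

section TensorCalculus

variable {p q : ℕ} {E E' F : Type*} [NormedAddCommGroup E] [NormedSpace ℝ E]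
  [NormedAddCommGroup E'] [NormedSpace ℝ E'] [NormedAddCommGroup F] [NormedSpace ℝ F]

variable (p q E) in
/-- The space of tensors on a finite-dimensional space is finite-dimensional. -/
theorem Tensor.finiteDimensional [FiniteDimensional ℝ E] :
    FiniteDimensional ℝ (Tensor p q E) := by
  have h1 : FiniteDimensional ℝ
      (ContinuousMultilinearMap ℝ (fun _ : Fin q => E →L[ℝ] ℝ) ℝ) :=
    Module.Finite.of_injective
      (ContinuousMultilinearMap.toMultilinearMapLinear :
        ContinuousMultilinearMap ℝ (fun _ : Fin q => E →L[ℝ] ℝ) ℝ →ₗ[ℝ] _)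
      ContinuousMultilinearMap.toMultilinearMap_injective
  exact Module.Finite.of_injective
      (ContinuousMultilinearMap.toMultilinearMapLinear : Tensor p q E →ₗ[ℝ] _)
      ContinuousMultilinearMap.toMultilinearMap_injective

/-- Bilinear maps on finite-dimensional spaces are continuous. -/
theorem exists_continuousBilinear {P Q R : Type*} [NormedAddCommGroup P] [NormedSpace ℝ P]
    [FiniteDimensional ℝ P] [NormedAddCommGroup Q] [NormedSpace ℝ Q] [FiniteDimensional ℝ Q]
    [NormedAddCommGroup R] [NormedSpace ℝ R] (b : P →ₗ[ℝ] Q →ₗ[ℝ] R) :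
    ∃ b' : P →L[ℝ] Q →L[ℝ] R, ∀ x y, b' x y = b x y :=
  ⟨LinearMap.toContinuousLinearMap
    ((LinearMap.toContinuousLinearMap (𝕜 := ℝ) (E := Q) (F' := R)).toLinearMap ∘ₗ b),
    fun _ _ => rfl⟩

variable (p q E) in
/-- The derivation action as a bilinear map. -/
def Tensor.derivationLin : (E →L[ℝ] E) →ₗ[ℝ] Tensor p q E →ₗ[ℝ] Tensor p q E :=
  LinearMap.mk₂ ℝ Tensor.derivation Tensor.derivation_add_left
    Tensor.derivation_smul_left Tensor.derivation_add_right Tensor.derivation_smul_right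

variable (p q E) in
theorem Tensor.exists_derivationL [FiniteDimensional ℝ E] :
    ∃ b : (E →L[ℝ] E) →L[ℝ] Tensor p q E →L[ℝ] Tensor p q E,
      ∀ D A, b D A = Tensor.derivationLin p q E D A := by
  have := Tensor.finiteDimensional p q E
  exact exists_continuousBilinear (P := E →L[ℝ] E) (Q := Tensor p q E) (R := Tensor p q E)
    (Tensor.derivationLin p q E)

variable (p q E) in
/-- The derivation action as a continuous bilinear map. -/
def Tensor.derivationL [FiniteDimensional ℝ E] :
    (E →L[ℝ] E) →L[ℝ] Tensor p q E →L[ℝ] Tensor p q E :=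
  (Tensor.exists_derivationL p q E).choose

theorem Tensor.derivationL_apply [FiniteDimensional ℝ E] (D : E →L[ℝ] E) (A : Tensor p q E) :
    Tensor.derivationL p q E D A = Tensor.derivation D A :=
  (Tensor.exists_derivationL p q E).choose_spec D A

theorem contDiffAt_compContinuousMultilinearMap {P Q R : Type*} [NormedAddCommGroup P]
    [NormedSpace ℝ P] [NormedAddCommGroup Q] [NormedSpace ℝ Q] [NormedAddCommGroup R]
    [NormedSpace ℝ R] {n : ℕ∞ω} {g : F → Q →L[ℝ] R}
    {f : F → ContinuousMultilinearMap ℝ (fun _ : Fin p => P) Q} {z : F}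
    (hg : ContDiffAt ℝ n g z) (hf : ContDiffAt ℝ n f z) :
    ContDiffAt ℝ n (fun z => (g z).compContinuousMultilinearMap (f z)) z := by
  have h : ContDiff ℝ n
      (ContinuousLinearMap.compContinuousMultilinearMapL ℝ (fun _ : Fin p => P) Q R) :=
    ContinuousLinearMap.contDiff _
  exact (h.contDiffAt.comp z hg).clm_apply hf

theorem contDiffAt_tensorPullback [CompleteSpace E] {n : ℕ∞ω} {A : F → E →L[ℝ] E'}
    {T : F → Tensor p q E'} {z : F} (hA : ContDiffAt ℝ n A z) (hT : ContDiffAt ℝ n T z)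
    (hi : (A z).IsInvertible) :
    ContDiffAt ℝ n (fun z => Tensor.pullback (A z) (T z)) z := by
  have h1 : ContDiffAt ℝ n (fun z => (A z).inverse) z := hi.contDiffAt_map_inverse.comp z hA
  have h2 : ContDiffAt ℝ n
      (fun z => (ContinuousLinearMap.compL ℝ E' E ℝ).flip (A z).inverse) z :=
    (ContinuousLinearMap.compL ℝ E' E ℝ).flip.contDiff.contDiffAt.comp z h1
  have h3 : ContDiffAt ℝ n (fun z =>
      ContinuousMultilinearMap.compContinuousLinearMapContinuousMultilinear ℝ
        (fun _ : Fin q => E →L[ℝ] ℝ) (fun _ : Fin q => E' →L[ℝ] ℝ) ℝ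
        (fun _ => (ContinuousLinearMap.compL ℝ E' E ℝ).flip (A z).inverse)) z :=
    (ContinuousMultilinearMap.contDiff _).contDiffAt.comp z (contDiffAt_pi.2 fun _ => h2)
  have h4 : ContDiffAt ℝ n (fun z =>
      ContinuousMultilinearMap.compContinuousLinearMapContinuousMultilinear ℝ
        (fun _ : Fin p => E) (fun _ : Fin p => E')
        (ContinuousMultilinearMap ℝ (fun _ : Fin q => E' →L[ℝ] ℝ) ℝ) (fun _ => A z)) z :=
    (ContinuousMultilinearMap.contDiff _).contDiffAt.comp z (contDiffAt_pi.2 fun _ => hA)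
  exact contDiffAt_compContinuousMultilinearMap h3 (h4.clm_apply hT)

theorem eventually_isInvertible {Z : Type*} [TopologicalSpace Z] [CompleteSpace E]
    {A : Z → E →L[ℝ] E'} {z : Z} (hA : ContinuousAt A z) (hi : (A z).IsInvertible) :
    ∀ᶠ y in 𝓝 z, (A y).IsInvertible := by
  obtain ⟨e, he⟩ := hi
  exact hA.preimage_mem_nhds (t := Set.range ((↑) : (E ≃L[ℝ] E') → E →L[ℝ] E')) (he ▸ e.nhds)

/-- The derivative of `A ↦ A⁻¹` along a differentiable family. -/
theorem differentiableAt_inverse_family [CompleteSpace E] {A : F → E →L[ℝ] E'} {z : F}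
    (hA : DifferentiableAt ℝ A z) (hi : (A z).IsInvertible) :
    DifferentiableAt ℝ (fun z => (A z).inverse) z ∧
    ∀ w, fderiv ℝ (fun z => (A z).inverse) z w =
      -((A z).inverse ∘L (fderiv ℝ A z w) ∘L (A z).inverse) := by
  have hN : DifferentiableAt ℝ (fun z => (A z).inverse) z :=
    (hi.contDiffAt_map_inverse.differentiableAt one_ne_zero).comp z hA
  refine ⟨hN, fun w => ?_⟩
  -- differentiate `A A⁻¹ = 1` and apply `A⁻¹` on the left
  have h0 : (fun y => A y ∘L (A y).inverse) =ᶠ[𝓝 z] fun _ => ContinuousLinearMap.id ℝ E' := by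
    filter_upwards [eventually_isInvertible hA.continuousAt hi] with y hy
      using hy.self_comp_inverse
  have h1 := (hA.hasFDerivAt.clm_comp hN.hasFDerivAt).fderiv
  rw [h0.fderiv_eq, fderiv_fun_const] at h1
  have h2 := congrArg (fun T : F →L[ℝ] E' →L[ℝ] E' => (A z).inverse ∘L T w) h1
  ext u
  have h3 := congrArg (fun T : E' →L[ℝ] E => T u) h2
  simp [hi.inverse_apply_self] at h3 ⊢
  exact eq_neg_of_add_eq_zero_left h3.symm

/-- The derivative of a pull-back `A^* T`, where both the isomorphism `A` and the tensor `T` vary: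
a variation of `A` acts through the derivation action of `A' A⁻¹`. -/
theorem fderiv_tensorPullback_apply [CompleteSpace E] {A : F → E →L[ℝ] E'}
    {T : F → Tensor p q E'} {z : F} (hA : DifferentiableAt ℝ A z) (hT : DifferentiableAt ℝ T z)
    (hi : (A z).IsInvertible) (w : F) :
    fderiv ℝ (fun z => Tensor.pullback (A z) (T z)) z w =
      Tensor.pullback (A z)
        (fderiv ℝ T z w + Tensor.derivation (fderiv ℝ A z w ∘L (A z).inverse) (T z)) := by
  have hd : DifferentiableAt ℝ (fun z => Tensor.pullback (A z) (T z)) z := by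
    have h := contDiffAt_tensorPullback (n := 1) (F := (E →L[ℝ] E') × Tensor p q E')
      (z := (A z, T z)) contDiffAt_fst contDiffAt_snd hi
    exact (h.differentiableAt one_ne_zero).comp z (hA.prodMk hT)
  obtain ⟨hN, hN'⟩ := differentiableAt_inverse_family hA hi
  refine Tensor.ext_apply fun v η => ?_
  have e1 : fderiv ℝ (fun z => Tensor.pullback (A z) (T z)) z w v η =
      fderiv ℝ (fun z => T z (fun i => A z (v i)) (fun j => (η j) ∘L (A z).inverse)) z w := by
    have := ((hd.hasFDerivAt.continuousMultilinear_apply_const v).continuousMultilinear_apply_const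
      η).fderiv
    simp only [Tensor.pullback_apply] at this
    rw [this]
    rfl
  have hv : ∀ i, HasFDerivAt (fun z => A z (v i)) ((fderiv ℝ A z).flip (v i)) z := fun i => by
    simpa using hA.hasFDerivAt.clm_apply (hasFDerivAt_const (v i) z)
  have hη : ∀ j, HasFDerivAt (fun z => (η j) ∘L (A z).inverse)
      ((ContinuousLinearMap.compL ℝ E' E ℝ (η j)) ∘L
        (fderiv ℝ (fun z => (A z).inverse) z)) z := fun j =>
    (ContinuousLinearMap.compL ℝ E' E ℝ (η j)).hasFDerivAt.comp z hN.hasFDerivAt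
  -- evaluated at fixed vectors and covectors, everything reduces to the product rule
  have e2 := ((hT.hasFDerivAt.continuousMultilinearMap_apply hv).continuousMultilinearMap_apply
    hη).fderiv
  rw [e1, e2, Tensor.pullback_apply]
  have hneg : ∀ (S : ContinuousMultilinearMap ℝ (fun _ : Fin q => E' →L[ℝ] ℝ) ℝ)
      (m : Fin q → E' →L[ℝ] ℝ) (j : Fin q) (x : E' →L[ℝ] ℝ),
      S (Function.update m j (-x)) = -S (Function.update m j x) :=
    fun S m j x => S.toMultilinearMap.map_update_neg m j x
  simp only [add_apply, sum_apply, ContinuousLinearMap.comp_apply,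
    ContinuousMultilinearMap.apply_apply, ContinuousMultilinearMap.toContinuousLinearMap_apply,
    ContinuousLinearMap.flip_apply, ContinuousLinearMap.compL_apply, hN',
    ContinuousLinearMap.comp_neg, hneg, Finset.sum_neg_distrib,
    Tensor.derivation_apply, hi.inverse_apply_self, ContinuousLinearMap.comp_assoc]
  abel

end TensorCalculus

/-! ### The Lie derivative in coordinates -/

section FlatLie

variable {p q : ℕ} {E : Type*} [NormedAddCommGroup E] [NormedSpace ℝ E]

/-- Naturality of the Lie derivative under a change of coordinates `σ`: the second derivative of `σ`
enters both through the differential of the transformed vector field and through the derivative of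
the pulled-back tensor, and cancels because it is symmetric. -/
theorem flatLieDeriv_pullback [CompleteSpace E] {σ : E → E} {ξ : E → E} {B : E → Tensor p q E}
    {u : E} (hσ : ContDiffAt ℝ 2 σ u) (hi : (fderiv ℝ σ u).IsInvertible)
    (hξ : DifferentiableAt ℝ ξ (σ u)) (hB : DifferentiableAt ℝ B (σ u)) :
    flatLieDeriv (fun z => (fderiv ℝ σ z).inverse (ξ (σ z)))
        (fun z => Tensor.pullback (fderiv ℝ σ z) (B (σ z))) u =
      Tensor.pullback (fderiv ℝ σ u) (flatLieDeriv ξ B (σ u)) := by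
  have hσ1 : DifferentiableAt ℝ σ u := hσ.differentiableAt two_ne_zero
  have hA : DifferentiableAt ℝ (fderiv ℝ σ) u :=
    (hσ.fderiv_right (m := 1) (by norm_num)).differentiableAt one_ne_zero
  have hsymm : IsSymmSndFDerivAt ℝ σ u := hσ.isSymmSndFDerivAt (by simp)
  set ξ' : E → E := fun z => (fderiv ℝ σ z).inverse (ξ (σ z))
  have hξ'd : DifferentiableAt ℝ ξ' u :=
    (differentiableAt_inverse_family hA hi).1.clm_apply (hξ.comp u hσ1)
  have hpush : fderiv ℝ σ u (ξ' u) = ξ (σ u) := hi.self_apply_inverse _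
  -- differentiate `dσ (ξ') = ξ ∘ σ`
  have hD : fderiv ℝ σ u ∘L fderiv ℝ ξ' u + fderiv ℝ (fderiv ℝ σ) u (ξ' u) =
      fderiv ℝ ξ (σ u) ∘L fderiv ℝ σ u := by
    have hev : (fun z => fderiv ℝ σ z (ξ' z)) =ᶠ[𝓝 u] ξ ∘ σ := by
      filter_upwards [eventually_isInvertible hA.continuousAt hi] with z hz
      exact hz.self_apply_inverse _
    have h1 := hev.fderiv_eq (𝕜 := ℝ)
    rw [fderiv_comp u hξ hσ1, (hA.hasFDerivAt.clm_apply hξ'd.hasFDerivAt).fderiv] at h1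
    rw [← h1]
    refine ContinuousLinearMap.ext fun v : E => ?_
    have h2 := hsymm.eq (ξ' u) v
    simp only [add_apply, ContinuousLinearMap.comp_apply, ContinuousLinearMap.flip_apply, h2]
  rw [flatLieDeriv, fderiv_tensorPullback_apply hA (T := fun z => B (σ z))
      (hB.comp u hσ1) hi, Tensor.pullback_add,
    flatLieDeriv, Tensor.pullback_add, add_assoc]
  congr 1
  · rw [fderiv_fun_comp u hB hσ1, ContinuousLinearMap.comp_apply, hpush]
  · rw [Tensor.derivation_pullback hi
      (D₂ := fderiv ℝ σ u ∘L fderiv ℝ ξ' u ∘L (fderiv ℝ σ u).inverse), ← Tensor.pullback_add,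
      ← Tensor.derivation_add_left]
    · congr 2
      rw [← ContinuousLinearMap.comp_assoc, ← ContinuousLinearMap.add_comp, add_comm, hD,
        ContinuousLinearMap.comp_assoc, hi.self_comp_inverse, ContinuousLinearMap.comp_id]
    · rw [ContinuousLinearMap.comp_assoc, ContinuousLinearMap.comp_assoc, hi.inverse_comp_self,
        ContinuousLinearMap.comp_id]

theorem flatLieDeriv_smul_left (c : ℝ) (ξ : E → E) (B : E → Tensor p q E) :
    flatLieDeriv (c • ξ) B = c • flatLieDeriv ξ B := by
  funext y
  simp only [flatLieDeriv, Pi.smul_apply, fderiv_const_smul_field, map_smul, smul_add,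
    Tensor.derivation_smul_left]

theorem flatLieDeriv_smul_right (c : ℝ) (ξ : E → E) (B : E → Tensor p q E) :
    flatLieDeriv ξ (c • B) = c • flatLieDeriv ξ B := by
  funext y
  have h : fderiv ℝ (c • B) y (ξ y) = c • fderiv ℝ B y (ξ y) :=
    congrArg (fun T => T y (ξ y)) (fderiv_const_smul_field (𝕜 := ℝ) (f := B) c)
  simp only [flatLieDeriv, Pi.smul_apply, h, smul_add, Tensor.derivation_smul_right]

theorem flatLieDeriv_congr {ξ ξ' : E → E} {B B' : E → Tensor p q E} {y : E}
    (hξ : ξ =ᶠ[𝓝 y] ξ') (hB : B =ᶠ[𝓝 y] B') : flatLieDeriv ξ B y = flatLieDeriv ξ' B' y := by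
  rw [flatLieDeriv, flatLieDeriv, hξ.fderiv_eq, hB.fderiv_eq, hξ.eq_of_nhds, hB.eq_of_nhds]

end FlatLie

/-! ### Time-dependent fields -/

section TimeDependent

variable {p q : ℕ} {E G : Type*} [NormedAddCommGroup E] [NormedSpace ℝ E]
  [NormedAddCommGroup G] [NormedSpace ℝ G]

/-- The time derivative of a function on `ℝ × E`. -/
def timePartial (g : ℝ × E → G) (z : ℝ × E) : G := fderiv ℝ g z (1, 0)

theorem analyticAt_timePartial [CompleteSpace G] {g : ℝ × E → G} {z : ℝ × E}
    (hg : AnalyticAt ℝ g z) : AnalyticAt ℝ (timePartial g) z :=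
  ((ContinuousLinearMap.apply ℝ G ((1, 0) : ℝ × E)).analyticAt _).comp hg.fderiv

theorem hasDerivAt_slice {g : ℝ × E → G} {z : ℝ × E} (hg : DifferentiableAt ℝ g z) :
    HasDerivAt (fun s => g (s, z.2)) (timePartial g z) z.1 := by
  have h1 : HasDerivAt (fun s : ℝ => (s, z.2)) ((1, 0) : ℝ × E) z.1 :=
    (hasDerivAt_id _).prodMk (hasDerivAt_const _ _)
  exact HasFDerivAt.comp_hasDerivAt z.1 (l := g) hg.hasFDerivAt h1

theorem differentiableAt_slice {g : ℝ × E → G} {z : ℝ × E} (hg : DifferentiableAt ℝ g z) :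
    DifferentiableAt ℝ (fun y => g (z.1, y)) z.2 :=
  DifferentiableAt.comp z.2 (g := g) hg (hasFDerivAt_prodMk_right z.1 z.2).differentiableAt

theorem fderiv_slice {g : ℝ × E → G} {z : ℝ × E} (hg : DifferentiableAt ℝ g z) :
    fderiv ℝ (fun y => g (z.1, y)) z.2 = fderiv ℝ g z ∘L ContinuousLinearMap.inr ℝ ℝ E :=
  (HasFDerivAt.comp z.2 (g := g) hg.hasFDerivAt (hasFDerivAt_prodMk_right z.1 z.2)).fderiv

theorem eventually_slice {Z : Type*} [TopologicalSpace Z] {P : ℝ × Z → Prop} {z : ℝ × Z}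
    (h : ∀ᶠ w in 𝓝 z, P w) :
    ∀ᶠ s in 𝓝 z.1, P (s, z.2) :=
  (Continuous.prodMk_left z.2).continuousAt.eventually h

/-- The iterated time derivatives of an analytic function are derivatives along time slices. -/
theorem iteratedDeriv_slice [CompleteSpace G] {g : ℝ × E → G} (m : ℕ) {z : ℝ × E}
    (hg : AnalyticAt ℝ g z) :
    AnalyticAt ℝ (timePartial^[m] g) z ∧
      iteratedDeriv m (fun s => g (s, z.2)) z.1 = timePartial^[m] g z := by
  induction m generalizing z with
  | zero => exact ⟨hg, by simp⟩
  | succ m ih =>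
    rw [Function.iterate_succ_apply']
    refine ⟨analyticAt_timePartial (ih hg).1, ?_⟩
    have hev : iteratedDeriv m (fun s => g (s, z.2)) =ᶠ[𝓝 z.1]
        fun s => timePartial^[m] g (s, z.2) := by
      filter_upwards [eventually_slice hg.eventually_analyticAt] with s hs using (ih hs).2
    rw [iteratedDeriv_succ, hev.deriv_eq]
    exact (hasDerivAt_slice (ih hg).1.differentiableAt).deriv

/-- The Lie derivative `L_{ξ_t} B_t` of a time-dependent tensor field along a time-dependent vector
field; see `flatLieDeriv_slice`. -/
def spaceLie (ξ : ℝ × E → E) (B : ℝ × E → Tensor p q E) (z : ℝ × E) : Tensor p q E :=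
  fderiv ℝ B z (0, ξ z) +
    Tensor.derivation (fderiv ℝ ξ z ∘L ContinuousLinearMap.inr ℝ ℝ E) (B z)

theorem flatLieDeriv_slice {ξ : ℝ × E → E} {B : ℝ × E → Tensor p q E} {z : ℝ × E}
    (hξ : DifferentiableAt ℝ ξ z) (hB : DifferentiableAt ℝ B z) :
    flatLieDeriv (fun y => ξ (z.1, y)) (fun y => B (z.1, y)) z.2 = spaceLie ξ B z := by
  rw [flatLieDeriv, fderiv_slice hξ, fderiv_slice hB]
  rfl

theorem analyticAt_spaceLie [FiniteDimensional ℝ E] {ξ : ℝ × E → E} {B : ℝ × E → Tensor p q E}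
    {z : ℝ × E} (hξ : AnalyticAt ℝ ξ z) (hB : AnalyticAt ℝ B z) :
    AnalyticAt ℝ (spaceLie ξ B) z := by
  have : CompleteSpace E := FiniteDimensional.complete ℝ E
  have h1 : ContDiffAt ℝ ω (fun z => (Tensor.derivationL p q E)
      (fderiv ℝ ξ z ∘L ContinuousLinearMap.inr ℝ ℝ E) (B z)) z :=
    ((Tensor.derivationL p q E).contDiff.contDiffAt.comp z
      (hξ.fderiv.contDiffAt.clm_comp contDiffAt_const)).clm_apply hB.contDiffAt
  have h2 : ContDiffAt ℝ ω (fun z => fderiv ℝ B z (0, ξ z)) z :=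
    hB.fderiv.contDiffAt.clm_apply (contDiffAt_const.prodMk hξ.contDiffAt)
  simp only [Tensor.derivationL_apply] at h1
  exact (h2.add h1).analyticAt

/-- The Leibniz rule `∂_t (L_ξ B) = L_{∂_t ξ} B + L_ξ (∂_t B)`. -/
theorem timePartial_spaceLie [FiniteDimensional ℝ E] {ξ : ℝ × E → E} {B : ℝ × E → Tensor p q E}
    {z : ℝ × E} (hξ : AnalyticAt ℝ ξ z) (hB : AnalyticAt ℝ B z) :
    timePartial (spaceLie ξ B) z =
      spaceLie ξ (timePartial B) z + spaceLie (timePartial ξ) B z := by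
  have : CompleteSpace E := FiniteDimensional.complete ℝ E
  have hsB : IsSymmSndFDerivAt ℝ B z := (hB.contDiffAt (n := ω)).isSymmSndFDerivAt (by simp)
  have hsξ : IsSymmSndFDerivAt ℝ ξ z := (hξ.contDiffAt (n := ω)).isSymmSndFDerivAt (by simp)
  have hdB := hB.fderiv.differentiableAt
  have hdξ := hξ.fderiv.differentiableAt
  -- partial derivatives commute
  have key : ∀ {G : Type _} [NormedAddCommGroup G] [NormedSpace ℝ G] {g : ℝ × E → G} (v : ℝ × E),
      DifferentiableAt ℝ (fderiv ℝ g) z → IsSymmSndFDerivAt ℝ g z →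
      fderiv ℝ (timePartial g) z v = fderiv ℝ (fderiv ℝ g) z (1, 0) v := by
    intro G _ _ g v hd hs
    have h := (hd.hasFDerivAt.clm_apply (hasFDerivAt_const ((1, 0) : ℝ × E) z)).fderiv
    have h' : fderiv ℝ (timePartial g) z v = fderiv ℝ (fun y => fderiv ℝ g y (1, 0)) z v := rfl
    rw [h', h, hs.eq (1, 0) v]
    simp
  have e1 : HasFDerivAt (fun z => fderiv ℝ B z (0, ξ z)) _ z :=
    hdB.hasFDerivAt.clm_apply
      ((hasFDerivAt_const (0 : ℝ) z).prodMk hξ.differentiableAt.hasFDerivAt)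
  have e2 : HasFDerivAt (fun z => (Tensor.derivationL p q E)
      (fderiv ℝ ξ z ∘L ContinuousLinearMap.inr ℝ ℝ E) (B z)) _ z :=
    (Tensor.derivationL p q E).hasFDerivAt_of_bilinear
      (hdξ.hasFDerivAt.clm_comp (hasFDerivAt_const (ContinuousLinearMap.inr ℝ ℝ E) z))
      hB.differentiableAt.hasFDerivAt
  have e3 := (e1.add e2).fderiv
  have e4 : timePartial (spaceLie ξ B) z = fderiv ℝ ((fun z => fderiv ℝ B z (0, ξ z)) +
    (fun z => (Tensor.derivationL p q E)
      (fderiv ℝ ξ z ∘L ContinuousLinearMap.inr ℝ ℝ E) (B z))) z (1, 0) := by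
    rw [timePartial]
    congr 2
    funext y
    simp [spaceLie, Tensor.derivationL_apply]
  have e5 : fderiv ℝ (timePartial ξ) z ∘L ContinuousLinearMap.inr ℝ ℝ E =
      fderiv ℝ (fderiv ℝ ξ) z (1, 0) ∘L ContinuousLinearMap.inr ℝ ℝ E := by
    ext v
    exact key _ hdξ hsξ
  rw [e4, e3, spaceLie, spaceLie, key _ hdB hsB, e5]
  simp [Tensor.derivationL_apply, timePartial]
  abel

/-- Near `(0, y₀)`, a jointly analytic function `g (t, y)` is the sum of its Taylor series
in `t` at `t = 0`, with a radius that does not depend on `y`: the joint power series at `(0, y₀)`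
can be recentered at `(0, y)` at the cost of shrinking its radius by the norm of `y - y₀`. -/
theorem eventually_hasSum_iteratedDeriv [CompleteSpace G] {g : ℝ × E → G} {y₀ : E}
    (hg : AnalyticAt ℝ g (0, y₀)) :
    ∀ᶠ z : ℝ × E in 𝓝 ((0 : ℝ), y₀), HasSum (fun k : ℕ => z.1 ^ k •
      ((k.factorial : ℝ)⁻¹ • iteratedDeriv k (fun s => g (s, z.2)) 0)) (g z) := by
  obtain ⟨P, r, hP⟩ := hg
  have hr : 0 < r / 2 := ENNReal.half_pos hP.r_pos.ne'
  have hev : ∀ᶠ z : ℝ × E in 𝓝 ((0 : ℝ), y₀), z ∈ Metric.eball ((0 : ℝ), y₀) (r / 2) :=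
    Metric.eball_mem_nhds _ hr
  filter_upwards [hev] with z hz
  have hz' : max (edist z.1 0) (edist z.2 y₀) < r / 2 := hz
  have h1 : edist z.2 y₀ < r / 2 := (le_max_right _ _).trans_lt hz'
  have h2 : edist z.1 0 < r / 2 := (le_max_left _ _).trans_lt hz'
  have hy : ‖((0 : ℝ), z.2 - y₀)‖₊ = ‖z.2 - y₀‖₊ := by
    simp [Prod.nnnorm_def]
  have hlt : (‖((0 : ℝ), z.2 - y₀)‖₊ : ENNReal) < r / 2 := by
    rw [hy, ← enorm_eq_nnnorm, ← edist_eq_enorm_sub]; exact h1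
  have hP' := hP.changeOrigin (hlt.trans_le ENNReal.half_le_self)
  have hpt : ((0 : ℝ), y₀) + ((0 : ℝ), z.2 - y₀) = (0, z.2) := by simp
  rw [hpt] at hP'
  have hmem : ((z.1, 0) : ℝ × E) ∈ Metric.eball 0
      (r - (‖((0 : ℝ), z.2 - y₀)‖₊ : ENNReal)) := by
    have : r / 2 ≤ r - (‖((0 : ℝ), z.2 - y₀)‖₊ : ENNReal) := by
      refine ENNReal.le_sub_of_add_le_right ENNReal.coe_ne_top ?_
      calc _ ≤ r / 2 + r / 2 := by gcongr
        _ = r := ENNReal.add_halves r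
    refine Metric.eball_subset_eball this ?_
    change max (edist z.1 0) (edist (0 : E) 0) < r / 2
    simpa using h2
  -- restrict the power series to the line `{(s, z.2)}`
  have hshift := hP'.comp_sub (-((0 : ℝ), z.2))
  have h0 : ((0 : ℝ), z.2) + -((0 : ℝ), z.2) = ContinuousLinearMap.inl ℝ ℝ E 0 := by simp
  rw [h0] at hshift
  have hline := hshift.compContinuousLinearMap
  have hfun : (fun w : ℝ × E => g (w - -((0 : ℝ), z.2))) ∘ ContinuousLinearMap.inl ℝ ℝ E =
      fun s => g (s, z.2) := by
    funext s; simp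
  rw [hfun] at hline
  have hs := hP'.hasSum hmem
  have hgz : ((0 : ℝ), z.2) + (z.1, 0) = z := by ext <;> simp
  rw [hgz] at hs
  convert! hs using 2 with k
  have hk := hline.factorial_smul 1 k
  rw [iteratedDeriv, ← hk, ← Nat.cast_smul_eq_nsmul ℝ,
    inv_smul_smul₀ (by exact_mod_cast k.factorial_ne_zero)]
  have hlin := ((P.changeOrigin ((0 : ℝ), z.2 - y₀)).compContinuousLinearMap
    (ContinuousLinearMap.inl ℝ ℝ E) k).map_smul_univ (fun _ => z.1) (fun _ => 1)
  simp only [Finset.prod_const, Finset.card_univ, Fintype.card_fin, smul_eq_mul, mul_one] at hlin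
  rw [← hlin]
  rfl

end TimeDependent

/-! ### Operators on time-dependent tensor fields -/

section Operators

variable {p q : ℕ} {E G : Type*} [NormedAddCommGroup E] [NormedSpace ℝ E]
  [NormedAddCommGroup G] [NormedSpace ℝ G]

/-- The space of functions that are analytic on `W` and vanish outside of `W`. The second condition
makes such a function determined by its restriction to `W`, so that identities between differential
operators on `W` become identities in a ring of endomorphisms. -/
def analyticFields (W : Set (ℝ × E)) (G : Type*) [NormedAddCommGroup G] [NormedSpace ℝ G] :
    Submodule ℝ (ℝ × E → G) where
  carrier := {B | AnalyticOnNhd ℝ B W ∧ ∀ z ∉ W, B z = 0}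
  add_mem' h h' := ⟨h.1.add h'.1, fun z hz => by simp [h.2 z hz, h'.2 z hz]⟩
  zero_mem' := ⟨analyticOnNhd_const, fun _ _ => rfl⟩
  smul_mem' c B h := ⟨h.1.const_smul, fun z hz => by simp [h.2 z hz]⟩

variable {W : Set (ℝ × E)}

instance : AddCommGroup (analyticFields W G) := Submodule.addCommGroup _

instance : Module ℝ (analyticFields W G) := Submodule.module _

theorem indicator_eventuallyEq {Z M : Type*} [TopologicalSpace Z] [Zero M] {W : Set Z}
    (hW : IsOpen W) (g : Z → M) {z : Z} (hz : z ∈ W) : W.indicator g =ᶠ[𝓝 z] g := by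
  filter_upwards [hW.mem_nhds hz] with y hy using Set.indicator_of_mem hy g

theorem indicator_mem_analyticFields (hW : IsOpen W) {g : ℝ × E → G} (hg : AnalyticOnNhd ℝ g W) :
    W.indicator g ∈ analyticFields W G :=
  ⟨fun z hz => (hg z hz).congr (indicator_eventuallyEq hW g hz).symm,
    fun _ hz => Set.indicator_of_notMem hz g⟩

/-- The time derivative as an operator on the fields that are analytic on `W`. -/
def timePartialOp [CompleteSpace G] (hW : IsOpen W) : Module.End ℝ (analyticFields W G) where
  toFun B := ⟨W.indicator (timePartial B.1),
    indicator_mem_analyticFields hW fun z hz => analyticAt_timePartial (B.2.1 z hz)⟩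
  map_add' B B' := by
    ext z
    by_cases hz : z ∈ W
    · have h := fderiv_add (B.2.1 z hz).differentiableAt (B'.2.1 z hz).differentiableAt
      simp [hz, timePartial, h]
    · simp [hz]
  map_smul' c B := by
    ext z
    by_cases hz : z ∈ W
    · have h := fderiv_const_smul (B.2.1 z hz).differentiableAt c
      simp [hz, timePartial, h]
    · simp [hz]

/-- The Lie derivative along the time-dependent vector field `ξ` as an operator on the tensor fields
that are analytic on `W`. -/
def spaceLieOp [FiniteDimensional ℝ E] (hW : IsOpen W) (ξ : ℝ × E → E) (hξ : AnalyticOnNhd ℝ ξ W) :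
    Module.End ℝ (analyticFields W (Tensor p q E)) where
  toFun B := ⟨W.indicator (spaceLie ξ B.1),
    indicator_mem_analyticFields hW fun z hz => analyticAt_spaceLie (hξ z hz) (B.2.1 z hz)⟩
  map_add' B B' := by
    refine Subtype.ext (funext fun z => ?_)
    by_cases hz : z ∈ W
    · have h := fderiv_add (B.2.1 z hz).differentiableAt (B'.2.1 z hz).differentiableAt
      have h' : fderiv ℝ (B.1 + B'.1) z (0, ξ z) =
        fderiv ℝ B.1 z (0, ξ z) + fderiv ℝ B'.1 z (0, ξ z) := by rw [h]; rfl
      simp only [Submodule.coe_add, Set.indicator_of_mem hz, Pi.add_apply, spaceLie, h',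
        Tensor.derivation_add_right]
      abel
    · simp [hz]
  map_smul' c B := by
    refine Subtype.ext (funext fun z => ?_)
    by_cases hz : z ∈ W
    · have h := fderiv_const_smul (B.2.1 z hz).differentiableAt c
      have h' : fderiv ℝ (c • B.1) z (0, ξ z) = c • fderiv ℝ B.1 z (0, ξ z) := by rw [h]; rfl
      simp only [Submodule.coe_smul, Set.indicator_of_mem hz, Pi.smul_apply, spaceLie, h',
        Tensor.derivation_smul_right, smul_add, RingHom.id_apply]
    · simp only [Submodule.coe_smul, Set.indicator_of_notMem hz, Pi.smul_apply, RingHom.id_apply]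
      exact (smul_zero (A := Tensor p q E) c).symm

/-- The operator `∂_t + L_ξ` on the tensor fields that are analytic on `W`. -/
def timeLieOp [FiniteDimensional ℝ E] (hW : IsOpen W) (ξ : ℝ × E → E) (hξ : AnalyticOnNhd ℝ ξ W) :
    Module.End ℝ (analyticFields W (Tensor p q E)) :=
  timePartialOp hW + spaceLieOp hW ξ hξ

/-- The commutation relation `[∂_t, L_ξ] = L_{∂_t ξ}`. -/
theorem timePartialOp_mul_spaceLieOp [FiniteDimensional ℝ E] (hW : IsOpen W) (ξ : ℝ × E → E)
    (hξ : AnalyticOnNhd ℝ ξ W) (hξ' : AnalyticOnNhd ℝ (timePartial ξ) W) :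
    timePartialOp hW * spaceLieOp (p := p) (q := q) hW ξ hξ =
      spaceLieOp hW ξ hξ * timePartialOp hW + spaceLieOp hW (timePartial ξ) hξ' := by
  refine LinearMap.ext fun B => Subtype.ext (funext fun z => ?_)
  by_cases hz : z ∈ W
  · have h1 : timePartial (W.indicator (spaceLie ξ B.1)) z = timePartial (spaceLie ξ B.1) z := by
      rw [timePartial, (indicator_eventuallyEq hW _ hz).fderiv_eq]; rfl
    have h2 : spaceLie ξ (W.indicator (timePartial B.1)) z = spaceLie ξ (timePartial B.1) z := by
      rw [spaceLie, (indicator_eventuallyEq hW _ hz).fderiv_eq,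
        (indicator_eventuallyEq hW _ hz).eq_of_nhds]; rfl
    have h3 := timePartial_spaceLie (hξ z hz) (B.2.1 z hz)
    simp only [Module.End.mul_apply, LinearMap.add_apply, Submodule.coe_add, Pi.add_apply,
      timePartialOp, spaceLieOp, LinearMap.coe_mk, AddHom.coe_mk, Set.indicator_of_mem hz, h1, h2,
      h3]
  · simp only [Module.End.mul_apply, LinearMap.add_apply, Submodule.coe_add, Pi.add_apply,
      timePartialOp, spaceLieOp, LinearMap.coe_mk, AddHom.coe_mk, Set.indicator_of_notMem hz,
      add_zero]

/-- The Lie derivatives `L_{ξ^{(m)}}` along the time derivatives of `ξ`. -/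
def lieOps (p q : ℕ) [FiniteDimensional ℝ E] (hW : IsOpen W) {ξ : ℝ × E → E}
    (hξ : ∀ m, AnalyticOnNhd ℝ (timePartial^[m] ξ) W) (m : ℕ) :
    Module.End ℝ (analyticFields W (Tensor p q E)) :=
  spaceLieOp hW (timePartial^[m] ξ) (hξ m)

/-- The higher product rule for `∂_t + L_ξ`, applied to a tensor field `B` that does not
depend on time. -/
theorem timeLieOp_pow_apply [FiniteDimensional ℝ E] (hW : IsOpen W) {ξ : ℝ × E → E}
    (hξ : ∀ m, AnalyticOnNhd ℝ (timePartial^[m] ξ) W) (B : analyticFields W (Tensor p q E))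
    (hB : timePartialOp hW B = 0) (k : ℕ) :
    (timeLieOp hW ξ (hξ 0) ^ k : Module.End ℝ (analyticFields W (Tensor p q E))) B =
      compositionSum (lieOps p q hW hξ) k B := by
  refine pow_add_apply_eq_compositionSum (lieOps p q hW hξ) (timePartialOp hW) (fun m => ?_) B hB k
  have hm : timePartial^[m + 1] ξ = timePartial (timePartial^[m] ξ) :=
    Function.iterate_succ_apply' _ _ _
  have h := hξ (m + 1)
  have := timePartialOp_mul_spaceLieOp (p := p) (q := q) hW (timePartial^[m] ξ) (hξ m) (hm ▸ h)
  rw [lieOps, lieOps, this]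
  congr 2
  exact hm.symm

/-! ### Pull-back along a flow -/

/-- The spatial derivative of `f (t, y)`. -/
def spaceDeriv (f : ℝ × E → E) (z : ℝ × E) : E →L[ℝ] E :=
  fderiv ℝ f z ∘L ContinuousLinearMap.inr ℝ ℝ E

/-- The pull-back `f_t^* B_t` of a time-dependent tensor field by a time-dependent map. -/
def flowPullback (f : ℝ × E → E) (B : ℝ × E → Tensor p q E) (z : ℝ × E) : Tensor p q E :=
  Tensor.pullback (spaceDeriv f z) (B (z.1, f z))

theorem analyticAt_spaceDeriv [CompleteSpace E] {f : ℝ × E → E} {z : ℝ × E}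
    (hf : AnalyticAt ℝ f z) : AnalyticAt ℝ (spaceDeriv f) z :=
  ((hf.fderiv.contDiffAt (n := ω)).clm_comp contDiffAt_const).analyticAt

theorem analyticAt_flowPullback [CompleteSpace E] {f : ℝ × E → E} {B : ℝ × E → Tensor p q E}
    {z : ℝ × E} (hf : AnalyticAt ℝ f z) (hi : (spaceDeriv f z).IsInvertible)
    (hB : AnalyticAt ℝ B (z.1, f z)) : AnalyticAt ℝ (flowPullback f B) z :=
  (contDiffAt_tensorPullback (n := ω) (analyticAt_spaceDeriv hf).contDiffAt
    (AnalyticAt.comp (g := B) (f := fun w : ℝ × E => (w.1, f w)) hB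
      (analyticAt_fst.prod hf)).contDiffAt hi).analyticAt

/-- If `f` is the flow of `ξ`, then `∂_t (f_t^* B_t) = f_t^* (∂_t B_t + L_{ξ_t} B_t)`. -/
theorem timePartial_flowPullback [CompleteSpace E] {f ξ : ℝ × E → E}
    {B : ℝ × E → Tensor p q E} {z : ℝ × E} (hf : AnalyticAt ℝ f z)
    (hi : (spaceDeriv f z).IsInvertible) (hξ : AnalyticAt ℝ ξ (z.1, f z))
    (hB : AnalyticAt ℝ B (z.1, f z))
    (hflow : timePartial f =ᶠ[𝓝 z] fun w => ξ (w.1, f w)) :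
    timePartial (flowPullback f B) z =
      flowPullback f (fun w => timePartial B w + spaceLie ξ B w) z := by
  have hsymm : IsSymmSndFDerivAt ℝ f z := (hf.contDiffAt (n := ω)).isSymmSndFDerivAt (by simp)
  have hdf := hf.fderiv.differentiableAt
  have hF : HasFDerivAt (fun w : ℝ × E => (w.1, f w))
      ((ContinuousLinearMap.fst ℝ ℝ E).prod (fderiv ℝ f z)) z :=
    hasFDerivAt_fst.prodMk hf.differentiableAt.hasFDerivAt
  have hA := (analyticAt_spaceDeriv hf).differentiableAt
  have hBF : HasFDerivAt (fun w : ℝ × E => B (w.1, f w)) _ z :=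
    HasFDerivAt.comp z (g := B) hB.differentiableAt.hasFDerivAt hF
  have hξF : HasFDerivAt (fun w : ℝ × E => ξ (w.1, f w)) _ z :=
    HasFDerivAt.comp z (g := ξ) hξ.differentiableAt.hasFDerivAt hF
  -- differentiate the flow equation in space: `∂_t (D f) = (D ξ) (D f)`
  have hA' : fderiv ℝ (spaceDeriv f) z (1, 0) =
      (fderiv ℝ ξ (z.1, f z) ∘L ContinuousLinearMap.inr ℝ ℝ E) ∘L spaceDeriv f z := by
    have h1 : HasFDerivAt (spaceDeriv f) _ z := hdf.hasFDerivAt.clm_comp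
      (hasFDerivAt_const (ContinuousLinearMap.inr ℝ ℝ E) z)
    have h2 : HasFDerivAt (timePartial f) _ z :=
      hdf.hasFDerivAt.clm_apply (hasFDerivAt_const ((1, 0) : ℝ × E) z)
    have h3 := hflow.fderiv_eq (𝕜 := ℝ)
    rw [h2.fderiv, hξF.fderiv] at h3
    rw [h1.fderiv]
    refine ContinuousLinearMap.ext fun v => ?_
    have h4 := congrArg (fun T : ℝ × E →L[ℝ] E => T (0, v)) h3
    have h5 := hsymm.eq (1, 0) (0, v)
    simp [spaceDeriv] at h4 ⊢
    rw [h5, h4]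
  have h0 : timePartial f z = ξ (z.1, f z) := hflow.eq_of_nhds
  have hT : fderiv ℝ (fun w : ℝ × E => B (w.1, f w)) z (1, 0) =
      timePartial B (z.1, f z) + fderiv ℝ B (z.1, f z) (0, ξ (z.1, f z)) := by
    rw [hBF.fderiv, timePartial, ← map_add, ← h0]
    simp [timePartial]
  have h := fderiv_tensorPullback_apply hA hBF.differentiableAt hi (1, 0)
  rw [hA', ContinuousLinearMap.comp_assoc, hi.self_comp_inverse, ContinuousLinearMap.comp_id,
    hT] at h
  rw [flowPullback, spaceLie, ← add_assoc]
  exact h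

/-- The higher time derivatives of the pull-back along a flow. -/
theorem iteratedDeriv_flowPullback [FiniteDimensional ℝ E] (hW : IsOpen W) {f ξ : ℝ × E → E}
    (hξ : AnalyticOnNhd ℝ ξ W) {V : Set (ℝ × E)} (hV : IsOpen V)
    (hf : ∀ z ∈ V, AnalyticAt ℝ f z) (hi : ∀ z ∈ V, (spaceDeriv f z).IsInvertible)
    (hVW : ∀ z ∈ V, (z.1, f z) ∈ W) (hflow : ∀ z ∈ V, timePartial f z = ξ (z.1, f z))
    (B : analyticFields W (Tensor p q E)) (k : ℕ) {z : ℝ × E} (hz : z ∈ V) :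
    iteratedDeriv k (fun s => flowPullback f B.1 (s, z.2)) z.1 =
      flowPullback f
        ((timeLieOp hW ξ hξ ^ k : Module.End ℝ (analyticFields W (Tensor p q E))) B).1 z := by
  have : CompleteSpace E := FiniteDimensional.complete ℝ E
  induction k generalizing z with
  | zero => simp
  | succ k ih =>
    set B' := (timeLieOp hW ξ hξ ^ k : Module.End ℝ (analyticFields W (Tensor p q E))) B with hB'
    have hev : iteratedDeriv k (fun s => flowPullback f B.1 (s, z.2)) =ᶠ[𝓝 z.1]
        fun s => flowPullback f B'.1 (s, z.2) := by
      filter_upwards [eventually_slice (hV.mem_nhds hz)] with s hs using ih hs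
    have hBz := B'.2.1 _ (hVW z hz)
    have hflow' : timePartial f =ᶠ[𝓝 z] fun w => ξ (w.1, f w) := by
      filter_upwards [hV.mem_nhds hz] with w hw using hflow w hw
    rw [iteratedDeriv_succ, hev.deriv_eq,
      (hasDerivAt_slice (analyticAt_flowPullback (hf z hz) (hi z hz) hBz).differentiableAt).deriv,
      timePartial_flowPullback (hf z hz) (hi z hz) (hξ _ (hVW z hz)) hBz hflow', pow_succ',
      Module.End.mul_apply, ← hB']
    simp only [flowPullback, timeLieOp, LinearMap.add_apply, Submodule.coe_add, Pi.add_apply,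
      timePartialOp, spaceLieOp, LinearMap.coe_mk, AddHom.coe_mk, Set.indicator_of_mem (hVW z hz)]

end Operators

/-! ### Coordinate expressions -/

section Charts

variable {p q : ℕ} {E : Type*} [NormedAddCommGroup E] [NormedSpace ℝ E]
  {X : Type*} [TopologicalSpace X] [ChartedSpace E X]

/-- The derivative of the preferred chart at `x₀`, as an endomorphism of the model space. -/
def chartDeriv (x₀ x : X) : E →L[ℝ] E :=
  mfderiv 𝓘(ℝ, E) 𝓘(ℝ, E) (extChartAt 𝓘(ℝ, E) x₀) x

/-- The derivative of the inverse of the preferred chart at `x₀`, as an endomorphism of the model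
space. -/
def chartSymmDeriv (x₀ : X) (y : E) : E →L[ℝ] E :=
  mfderiv 𝓘(ℝ, E) 𝓘(ℝ, E) (extChartAt 𝓘(ℝ, E) x₀).symm y

/-- The derivative of a map at `x`, as an endomorphism of the model space. -/
def mapDeriv (g : X → X) (x : X) : E →L[ℝ] E :=
  mfderiv 𝓘(ℝ, E) 𝓘(ℝ, E) g x

/-- The value at `x` of a tensor field, as a tensor on the model space: the tangent space at `x` is
by definition a copy of the model space. -/
def tensorAt (A : TensorField p q E X) (x : X) : Tensor p q E := A x

/-- The value at `x` of a vector field, as an element of the model space. -/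
def vectorAt (ξ : VectorField E X) (x : X) : E := ξ x

theorem tensorInChart_apply (x₀ : X) (A : TensorField p q E X) (y : E) :
    tensorInChart x₀ A y =
      Tensor.pullback (chartSymmDeriv x₀ y) (tensorAt A ((extChartAt 𝓘(ℝ, E) x₀).symm y)) :=
  rfl

theorem vectorInChart_apply (x₀ : X) (ξ : VectorField E X) (y : E) :
    vectorInChart x₀ ξ y =
      (chartSymmDeriv x₀ y).inverse (vectorAt ξ ((extChartAt 𝓘(ℝ, E) x₀).symm y)) :=
  rfl

theorem lieDeriv_apply (ξ : VectorField E X) (A : TensorField p q E X) (x : X) :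
    tensorAt (lieDeriv ξ A) x = Tensor.pullback (chartDeriv x x)
      (flatLieDeriv (vectorInChart x ξ) (tensorInChart x A) (extChartAt 𝓘(ℝ, E) x x)) :=
  rfl

theorem lieDeriv_smul_left (c : ℝ) (ξ : VectorField E X) (A : TensorField p q E X) :
    lieDeriv (c • ξ) A = c • lieDeriv ξ A := by
  funext x
  have h : vectorInChart x (c • ξ) = c • vectorInChart x ξ := by
    funext y
    exact map_smul (chartSymmDeriv x y).inverse c _
  change tensorAt (lieDeriv (c • ξ) A) x = c • tensorAt (lieDeriv ξ A) x
  rw [lieDeriv_apply, lieDeriv_apply, h, flatLieDeriv_smul_left, Pi.smul_apply,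
    Tensor.pullback_smul]

theorem lieDeriv_smul_right (c : ℝ) (ξ : VectorField E X) (A : TensorField p q E X) :
    lieDeriv ξ (c • A) = c • lieDeriv ξ A := by
  funext x
  have h : tensorInChart x (c • A) = c • tensorInChart x A := by
    funext y
    exact Tensor.pullback_smul (V := E) (W := E) _ c _
  change tensorAt (lieDeriv ξ (c • A)) x = c • tensorAt (lieDeriv ξ A) x
  rw [lieDeriv_apply, lieDeriv_apply, h, flatLieDeriv_smul_right, Pi.smul_apply,
    Tensor.pullback_smul]

theorem multiLieDeriv_ofFn_smul {n : ℕ} (a : Fin n → ℝ) (ξ : Fin n → VectorField E X)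
    (A : TensorField p q E X) :
    multiLieDeriv (List.ofFn fun j => a j • ξ j) A =
      (∏ j, a j) • multiLieDeriv (List.ofFn ξ) A := by
  induction n with
  | zero => simp [multiLieDeriv]
  | succ n ih =>
    have h := ih (fun j => a j.succ) (fun j => ξ j.succ)
    simp only [multiLieDeriv, List.ofFn_succ, List.foldr_cons, Fin.prod_univ_succ] at h ⊢
    rw [h, lieDeriv_smul_left, lieDeriv_smul_right, smul_smul]

/-- Normalizing the vector fields in an iterated Lie derivative produces the factor `C_λ / k!`. -/
theorem multiLieDeriv_timeCoeff {k : ℕ} (c : Composition k) (ξ : ℝ → VectorField E X)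
    (α : TensorField p q E X) :
    multiLieDeriv (List.ofFn fun j : Fin c.length => ((c.sizeUpTo (j + 1) : ℝ)⁻¹) •
        timeCoeff ξ (c.blocksFun j - 1)) α =
      ((k.factorial : ℝ)⁻¹ * compCoeff c) •
        multiLieDeriv (c.blocks.map fun m => timeDeriv ξ (m - 1) 0) α := by
  rw [← ofFn_blocksFun_map c fun m => timeDeriv ξ (m - 1) 0,
    ← compCoeff_eq_mul_prod, ← multiLieDeriv_ofFn_smul]
  congr 2
  funext j
  rw [mul_smul]
  rfl

theorem pullback_of_eq_id {g : X → X} (hg : ∀ x, g x = x) (A : TensorField p q E X) :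
    pullback g A = A := by
  have : g = id := funext hg
  subst this
  funext x
  have h : mapDeriv (E := E) (id : X → X) x = ContinuousLinearMap.id ℝ E := mfderiv_id
  have h' : tensorAt (pullback id A) x = Tensor.pullback (mapDeriv id x) (tensorAt A x) := rfl
  rw [h, Tensor.pullback_id] at h'
  exact h'

/-- A property that holds near `(0, x₀)` in the chart at `x₀` holds near `(0, x₀)` on `X`. -/
theorem eventually_of_chart {x₀ : X} {P : ℝ × E → Prop}
    (h : ∀ᶠ z in 𝓝 ((0 : ℝ), extChartAt 𝓘(ℝ, E) x₀ x₀), P z) :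
    ∀ᶠ z : ℝ × X in 𝓝 ((0 : ℝ), x₀), z.2 ∈ (extChartAt 𝓘(ℝ, E) x₀).source ∧
      P (z.1, extChartAt 𝓘(ℝ, E) x₀ z.2) ∧ P (0, extChartAt 𝓘(ℝ, E) x₀ z.2) := by
  have hc : ContinuousAt (fun z : ℝ × X => extChartAt 𝓘(ℝ, E) x₀ z.2) ((0 : ℝ), x₀) :=
    ContinuousAt.comp (g := extChartAt 𝓘(ℝ, E) x₀) (continuousAt_extChartAt x₀) continuousAt_snd
  have h1 : ∀ᶠ z : ℝ × X in 𝓝 ((0 : ℝ), x₀), z.2 ∈ (extChartAt 𝓘(ℝ, E) x₀).source :=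
    continuousAt_snd.eventually (extChartAt_source_mem_nhds x₀)
  have h2 := (continuousAt_fst.prodMk hc).eventually (p := P) h
  have h3 := ((continuousAt_const (y := (0 : ℝ))).prodMk hc).eventually (p := P) h
  filter_upwards [h1, h2, h3] with z hz1 hz2 hz3 using ⟨hz1, hz2, hz3⟩

variable [IsManifold 𝓘(ℝ, E) ω X]

theorem isManifold_one : IsManifold 𝓘(ℝ, E) 1 X := IsManifold.of_le (n := ω) le_top

theorem chartDeriv_comp_chartSymmDeriv {x₀ : X} {y : E}
    (hy : y ∈ (extChartAt 𝓘(ℝ, E) x₀).target) :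
    chartDeriv x₀ ((extChartAt 𝓘(ℝ, E) x₀).symm y) ∘L chartSymmDeriv x₀ y =
      ContinuousLinearMap.id ℝ E := by
  have := isManifold_one (E := E) (X := X)
  have h := mfderiv_extChartAt_comp_mfderivWithin_extChartAt_symm (I := 𝓘(ℝ, E)) hy
  rw [ModelWithCorners.range_eq_univ, mfderivWithin_univ] at h
  exact h

theorem chartSymmDeriv_comp_chartDeriv {x₀ : X} {y : E}
    (hy : y ∈ (extChartAt 𝓘(ℝ, E) x₀).target) :
    chartSymmDeriv x₀ y ∘L chartDeriv x₀ ((extChartAt 𝓘(ℝ, E) x₀).symm y) =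
      ContinuousLinearMap.id ℝ E := by
  have := isManifold_one (E := E) (X := X)
  have h := mfderivWithin_extChartAt_symm_comp_mfderiv_extChartAt (I := 𝓘(ℝ, E)) hy
  rw [ModelWithCorners.range_eq_univ, mfderivWithin_univ] at h
  exact h

theorem isInvertible_chartSymmDeriv {x₀ : X} {y : E}
    (hy : y ∈ (extChartAt 𝓘(ℝ, E) x₀).target) : (chartSymmDeriv x₀ y).IsInvertible :=
  .of_inverse (chartSymmDeriv_comp_chartDeriv hy) (chartDeriv_comp_chartSymmDeriv hy)

theorem inverse_chartSymmDeriv {x₀ : X} {y : E} (hy : y ∈ (extChartAt 𝓘(ℝ, E) x₀).target) :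
    (chartSymmDeriv x₀ y).inverse = chartDeriv x₀ ((extChartAt 𝓘(ℝ, E) x₀).symm y) :=
  ContinuousLinearMap.inverse_eq (chartSymmDeriv_comp_chartDeriv hy)
    (chartDeriv_comp_chartSymmDeriv hy)

theorem isInvertible_chartDeriv {x₀ x : X} (hx : x ∈ (extChartAt 𝓘(ℝ, E) x₀).source) :
    (chartDeriv (E := E) x₀ x).IsInvertible := by
  have := isManifold_one (E := E) (X := X)
  exact isInvertible_mfderiv_extChartAt hx

theorem pullback_chartDeriv_tensorInChart {x₀ x : X} (hx : x ∈ (extChartAt 𝓘(ℝ, E) x₀).source)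
    (A : TensorField p q E X) :
    Tensor.pullback (chartDeriv x₀ x) (tensorInChart x₀ A (extChartAt 𝓘(ℝ, E) x₀ x)) =
      tensorAt A x := by
  have h := chartSymmDeriv_comp_chartDeriv ((extChartAt 𝓘(ℝ, E) x₀).map_source hx)
  rw [(extChartAt 𝓘(ℝ, E) x₀).left_inv hx] at h
  rw [tensorInChart_apply, ← Tensor.pullback_comp (isInvertible_chartDeriv hx), h,
    (extChartAt 𝓘(ℝ, E) x₀).left_inv hx, Tensor.pullback_id]

theorem chartSymmDeriv_vectorInChart {x₀ x : X} (hx : x ∈ (extChartAt 𝓘(ℝ, E) x₀).source)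
    (ξ : VectorField E X) :
    chartSymmDeriv x₀ (extChartAt 𝓘(ℝ, E) x₀ x) (vectorInChart x₀ ξ (extChartAt 𝓘(ℝ, E) x₀ x)) =
      vectorAt ξ x := by
  rw [vectorInChart_apply,
    (isInvertible_chartSymmDeriv ((extChartAt 𝓘(ℝ, E) x₀).map_source hx)).self_apply_inverse,
    (extChartAt 𝓘(ℝ, E) x₀).left_inv hx]

theorem mdifferentiableAt_extChartAt_symm {x₀ : X} {y : E}
    (hy : y ∈ (extChartAt 𝓘(ℝ, E) x₀).target) :
    MDifferentiableAt 𝓘(ℝ, E) 𝓘(ℝ, E) (extChartAt 𝓘(ℝ, E) x₀).symm y := by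
  have := isManifold_one (E := E) (X := X)
  have h := mdifferentiableWithinAt_extChartAt_symm (I := 𝓘(ℝ, E)) hy
  rwa [ModelWithCorners.range_eq_univ, mdifferentiableWithinAt_univ] at h

theorem mdifferentiableAt_extChartAt_of_mem {x₀ x : X}
    (hx : x ∈ (extChartAt 𝓘(ℝ, E) x₀).source) :
    MDifferentiableAt 𝓘(ℝ, E) 𝓘(ℝ, E) (extChartAt 𝓘(ℝ, E) x₀) x := by
  have := isManifold_one (E := E) (X := X)
  exact mdifferentiableAt_extChartAt (by rwa [extChartAt_source] at hx)

/-- The chain rule for the coordinate expression of a map. -/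
theorem fderiv_chart_comp {g : X → X} {x₀ y₀ : X} {y : E}
    (hy : y ∈ (extChartAt 𝓘(ℝ, E) x₀).target)
    (hg : MDifferentiableAt 𝓘(ℝ, E) 𝓘(ℝ, E) g ((extChartAt 𝓘(ℝ, E) x₀).symm y))
    (hgy : g ((extChartAt 𝓘(ℝ, E) x₀).symm y) ∈ (extChartAt 𝓘(ℝ, E) y₀).source) :
    fderiv ℝ (fun y => extChartAt 𝓘(ℝ, E) y₀ (g ((extChartAt 𝓘(ℝ, E) x₀).symm y))) y =
      chartDeriv y₀ (g ((extChartAt 𝓘(ℝ, E) x₀).symm y)) ∘L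
        mapDeriv g ((extChartAt 𝓘(ℝ, E) x₀).symm y) ∘L
        chartSymmDeriv x₀ y := by
  have h1 := mdifferentiableAt_extChartAt_symm hy
  have h2 := mfderiv_comp y hg h1
  have h3 := mfderiv_comp y (g := extChartAt 𝓘(ℝ, E) y₀)
    (mdifferentiableAt_extChartAt_of_mem hgy) (hg.comp y h1)
  rw [h2] at h3
  rw [← mfderiv_eq_fderiv]
  exact h3

/-- The coordinate expression of a pulled-back tensor field. -/
theorem tensorAt_pullback {g : X → X} {x₀ y₀ x : X} (hx : x ∈ (extChartAt 𝓘(ℝ, E) x₀).source)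
    (hg : MDifferentiableAt 𝓘(ℝ, E) 𝓘(ℝ, E) g x)
    (hi : (mapDeriv (E := E) g x).IsInvertible)
    (hgx : g x ∈ (extChartAt 𝓘(ℝ, E) y₀).source) (A : TensorField p q E X) :
    tensorAt (pullback g A) x = Tensor.pullback (chartDeriv x₀ x)
      (Tensor.pullback (fderiv ℝ (fun y => extChartAt 𝓘(ℝ, E) y₀
          (g ((extChartAt 𝓘(ℝ, E) x₀).symm y))) (extChartAt 𝓘(ℝ, E) x₀ x))
        (tensorInChart y₀ A (extChartAt 𝓘(ℝ, E) y₀ (g x)))) := by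
  have hy := (extChartAt 𝓘(ℝ, E) x₀).map_source hx
  have hxy := (extChartAt 𝓘(ℝ, E) x₀).left_inv hx
  have h := fderiv_chart_comp (y₀ := y₀) hy (hxy.symm ▸ hg) (hxy.symm ▸ hgx)
  have h' := chartSymmDeriv_comp_chartDeriv hy
  rw [hxy] at h h'
  rw [h, ← Tensor.pullback_comp (isInvertible_chartDeriv hx), ContinuousLinearMap.comp_assoc,
    ContinuousLinearMap.comp_assoc, h', ContinuousLinearMap.comp_id, Tensor.pullback_comp hi,
    pullback_chartDeriv_tensorInChart hgx]
  rfl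

theorem contDiffAt_chart_comp {g : X → X} {x₀ y₀ : X} {y : E} {n : ℕ∞ω}
    (hy : y ∈ (extChartAt 𝓘(ℝ, E) x₀).target)
    (hg : ContMDiffAt 𝓘(ℝ, E) 𝓘(ℝ, E) n g ((extChartAt 𝓘(ℝ, E) x₀).symm y))
    (hgy : g ((extChartAt 𝓘(ℝ, E) x₀).symm y) ∈ (extChartAt 𝓘(ℝ, E) y₀).source) :
    ContDiffAt ℝ n (fun y => extChartAt 𝓘(ℝ, E) y₀ (g ((extChartAt 𝓘(ℝ, E) x₀).symm y))) y := by
  have : IsManifold 𝓘(ℝ, E) n X := IsManifold.of_le (n := ω) le_top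
  rw [← contMDiffAt_iff_contDiffAt]
  have h1 : ContMDiffAt 𝓘(ℝ, E) 𝓘(ℝ, E) n (extChartAt 𝓘(ℝ, E) x₀).symm y :=
    (contMDiffOn_extChartAt_symm x₀).contMDiffAt ((isOpen_extChartAt_target x₀).mem_nhds hy)
  exact ContMDiffAt.comp y (contMDiffAt_extChartAt' (by rwa [extChartAt_source] at hgy))
    (hg.comp y h1)

/-- The Lie derivative of a tensor field can be computed in any chart. -/
theorem tensorInChart_lieDeriv [CompleteSpace E] {x₀ : X} {y : E}
    (hy : y ∈ (extChartAt 𝓘(ℝ, E) x₀).target) {ξ : VectorField E X} {A : TensorField p q E X}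
    (hξ : DifferentiableAt ℝ (vectorInChart x₀ ξ) y)
    (hA : DifferentiableAt ℝ (tensorInChart x₀ A) y) :
    tensorInChart x₀ (lieDeriv ξ A) y =
      flatLieDeriv (vectorInChart x₀ ξ) (tensorInChart x₀ A) y := by
  have hc := extChartAt_to_inv (I := 𝓘(ℝ, E)) ((extChartAt 𝓘(ℝ, E) x₀).symm y)
  have hxs := (extChartAt 𝓘(ℝ, E) x₀).map_target hy
  have hyx := (extChartAt 𝓘(ℝ, E) x₀).right_inv hy
  have hK := chartDeriv_comp_chartSymmDeriv hy
  set x := (extChartAt 𝓘(ℝ, E) x₀).symm y with hx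
  set u := extChartAt 𝓘(ℝ, E) x x with hu
  have hut : u ∈ (extChartAt 𝓘(ℝ, E) x).target := mem_extChartAt_target x
  -- the change of coordinates from the preferred chart at `x` to the one at `x₀`
  set σ : E → E := fun z => extChartAt 𝓘(ℝ, E) x₀ ((extChartAt 𝓘(ℝ, E) x).symm z) with hσ
  have hσu : σ u = y := by rw [hσ]; simp only [hc]; exact hyx
  have hev : ∀ᶠ z in 𝓝 u, z ∈ (extChartAt 𝓘(ℝ, E) x).target ∧
      (extChartAt 𝓘(ℝ, E) x).symm z ∈ (extChartAt 𝓘(ℝ, E) x₀).source := by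
    refine Filter.Eventually.and (extChartAt_target_mem_nhds (I := 𝓘(ℝ, E)) x) ?_
    refine (continuousAt_extChartAt_symm x).preimage_mem_nhds ?_
    rw [hc]
    exact (isOpen_extChartAt_source x₀).mem_nhds hxs
  have hder : ∀ z, z ∈ (extChartAt 𝓘(ℝ, E) x).target →
      (extChartAt 𝓘(ℝ, E) x).symm z ∈ (extChartAt 𝓘(ℝ, E) x₀).source →
      fderiv ℝ σ z =
        chartDeriv x₀ ((extChartAt 𝓘(ℝ, E) x).symm z) ∘L chartSymmDeriv x z := by
    intro z hz hz'
    have h := fderiv_chart_comp (g := id) (y₀ := x₀) hz mdifferentiableAt_id hz'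
    have h' : mapDeriv (E := E) (id : X → X) ((extChartAt 𝓘(ℝ, E) x).symm z) =
      ContinuousLinearMap.id ℝ E := mfderiv_id
    rw [h', ContinuousLinearMap.id_comp] at h
    exact h
  have hBev : tensorInChart x A =ᶠ[𝓝 u]
      fun z => Tensor.pullback (fderiv ℝ σ z) (tensorInChart x₀ A (σ z)) := by
    filter_upwards [hev] with z hz
    rw [hder z hz.1 hz.2, Tensor.pullback_comp (isInvertible_chartSymmDeriv hz.1),
      pullback_chartDeriv_tensorInChart hz.2, tensorInChart_apply]
  have hξev : vectorInChart x ξ =ᶠ[𝓝 u]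
      fun z => (fderiv ℝ σ z).inverse (vectorInChart x₀ ξ (σ z)) := by
    filter_upwards [hev] with z hz
    have h := (extChartAt 𝓘(ℝ, E) x₀).map_source hz.2
    have h1 := inverse_chartSymmDeriv h
    rw [(extChartAt 𝓘(ℝ, E) x₀).left_inv hz.2] at h1
    rw [hder z hz.1 hz.2, (isInvertible_chartDeriv hz.2).inverse_comp_apply_of_left, ← h1,
      (isInvertible_chartSymmDeriv h).inverse_inverse, chartSymmDeriv_vectorInChart hz.2,
      vectorInChart_apply]
  have hσ2 : ContDiffAt ℝ 2 σ u :=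
    contDiffAt_chart_comp (g := id) (y₀ := x₀) hut contMDiffAt_id (by rw [hc]; exact hxs)
  have hdu := hder u hut (by rw [hc]; exact hxs)
  rw [hc] at hdu
  have hiu : (fderiv ℝ σ u).IsInvertible := by
    rw [hdu]
    exact (isInvertible_chartDeriv hxs).comp (isInvertible_chartSymmDeriv hut)
  have hsx : chartSymmDeriv x u ∘L chartDeriv x x = ContinuousLinearMap.id ℝ E := by
    have := chartSymmDeriv_comp_chartDeriv hut
    rwa [hc] at this
  rw [tensorInChart_apply, ← hx, lieDeriv_apply, ← hu, flatLieDeriv_congr hξev hBev,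
    flatLieDeriv_pullback hσ2 hiu (hσu.symm ▸ hξ) (hσu.symm ▸ hA), hσu,
    ← Tensor.pullback_comp (isInvertible_chartSymmDeriv hy),
    ← Tensor.pullback_comp ((isInvertible_chartDeriv (mem_extChartAt_source x)).comp
      (isInvertible_chartSymmDeriv hy)), hdu, ContinuousLinearMap.comp_assoc,
    ← ContinuousLinearMap.comp_assoc (chartSymmDeriv x u), hsx, ContinuousLinearMap.id_comp, hK,
    Tensor.pullback_id]

end Charts

/-! ### The flow in coordinates -/

section LocalFlow

variable {p q : ℕ} {E : Type*} [NormedAddCommGroup E] [NormedSpace ℝ E]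
  {X : Type*} [TopologicalSpace X] [ChartedSpace E X]

/-- The coordinate expression of `(t, x) ↦ φ_t x` in the charts at `x₀` and `y₀`. -/
def localFlow (φ : ℝ → X ≃ₘ^ω⟮𝓘(ℝ, E), 𝓘(ℝ, E)⟯ X) (x₀ y₀ : X) (z : ℝ × E) : E :=
  extChartAt 𝓘(ℝ, E) y₀ (φ z.1 ((extChartAt 𝓘(ℝ, E) x₀).symm z.2))

/-- The set on which `localFlow` is the coordinate expression of the flow. -/
def flowDomain (ε : ℝ) (φ : ℝ → X ≃ₘ^ω⟮𝓘(ℝ, E), 𝓘(ℝ, E)⟯ X) (x₀ y₀ : X) : Set (ℝ × E) :=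
  {z | z.1 ∈ Set.Ioo (-ε) ε ∧ z.2 ∈ (extChartAt 𝓘(ℝ, E) x₀).target ∧
    φ z.1 ((extChartAt 𝓘(ℝ, E) x₀).symm z.2) ∈ (extChartAt 𝓘(ℝ, E) y₀).source}

theorem self_mem_flowDomain {ε : ℝ} (φ : ℝ → X ≃ₘ^ω⟮𝓘(ℝ, E), 𝓘(ℝ, E)⟯ X) {t : ℝ}
    (ht : t ∈ Set.Ioo (-ε) ε) (x : X) :
    (t, extChartAt 𝓘(ℝ, E) x x) ∈ flowDomain ε φ x (φ t x) := by
  refine ⟨ht, mem_extChartAt_target x, ?_⟩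
  simp only [extChartAt_to_inv]
  exact mem_extChartAt_source _

theorem localFlow_self (φ : ℝ → X ≃ₘ^ω⟮𝓘(ℝ, E), 𝓘(ℝ, E)⟯ X) (t : ℝ) (x y₀ : X) :
    localFlow φ x y₀ (t, extChartAt 𝓘(ℝ, E) x x) = extChartAt 𝓘(ℝ, E) y₀ (φ t x) := by
  simp only [localFlow, extChartAt_to_inv]

/-- A family of automorphisms that is jointly analytic for times in `(-ε, ε)`. -/
def IsAnalyticFamily (ε : ℝ) (φ : ℝ → X ≃ₘ^ω⟮𝓘(ℝ, E), 𝓘(ℝ, E)⟯ X) : Prop :=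
  ContMDiffOn (𝓘(ℝ, ℝ).prod 𝓘(ℝ, E)) 𝓘(ℝ, E) ω (fun z : ℝ × X => φ z.1 z.2)
    (Set.Ioo (-ε) ε ×ˢ Set.univ)

theorem isInvertible_mapDeriv (g : X ≃ₘ^ω⟮𝓘(ℝ, E), 𝓘(ℝ, E)⟯ X) (x : X) :
    (mapDeriv (E := E) g x).IsInvertible :=
  ⟨g.mfderivToContinuousLinearEquiv (by simp) x, rfl⟩

variable {ε : ℝ} {φ : ℝ → X ≃ₘ^ω⟮𝓘(ℝ, E), 𝓘(ℝ, E)⟯ X}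

theorem contMDiffAt_flow (hφ : IsAnalyticFamily ε φ) {t : ℝ} (ht : t ∈ Set.Ioo (-ε) ε) (x : X) :
    ContMDiffAt (𝓘(ℝ, ℝ).prod 𝓘(ℝ, E)) 𝓘(ℝ, E) ω (fun z : ℝ × X => φ z.1 z.2) (t, x) :=
  hφ.contMDiffAt ((isOpen_Ioo.prod isOpen_univ).mem_nhds ⟨ht, Set.mem_univ x⟩)

theorem mdifferentiableAt_orbit (hφ : IsAnalyticFamily ε φ) {t : ℝ} (ht : t ∈ Set.Ioo (-ε) ε)
    (x : X) : MDifferentiableAt 𝓘(ℝ, ℝ) 𝓘(ℝ, E) (fun s => φ s x) t := by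
  have h : ContMDiffAt 𝓘(ℝ, ℝ) (𝓘(ℝ, ℝ).prod 𝓘(ℝ, E)) ω (fun s : ℝ => (s, x)) t :=
    contMDiffAt_id.prodMk contMDiffAt_const
  exact (ContMDiffAt.comp t (g := fun z : ℝ × X => φ z.1 z.2) (contMDiffAt_flow hφ ht x)
    h).mdifferentiableAt (by simp)

variable [IsManifold 𝓘(ℝ, E) ω X]

theorem contMDiffAt_flow_symm (hφ : IsAnalyticFamily ε φ) {x₀ : X} {z : ℝ × E}
    (ht : z.1 ∈ Set.Ioo (-ε) ε) (hz : z.2 ∈ (extChartAt 𝓘(ℝ, E) x₀).target) :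
    ContMDiffAt 𝓘(ℝ, ℝ × E) 𝓘(ℝ, E) ω
      (fun z : ℝ × E => φ z.1 ((extChartAt 𝓘(ℝ, E) x₀).symm z.2)) z := by
  have h1 : ContMDiffAt 𝓘(ℝ, E) 𝓘(ℝ, E) ω (extChartAt 𝓘(ℝ, E) x₀).symm z.2 :=
    (contMDiffOn_extChartAt_symm x₀).contMDiffAt ((isOpen_extChartAt_target x₀).mem_nhds hz)
  have h2 : ContMDiffAt 𝓘(ℝ, ℝ × E) 𝓘(ℝ, E) ω (Prod.snd : ℝ × E → E) z :=
    contDiff_snd.contMDiff.contMDiffAt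
  have h3 : ContMDiffAt 𝓘(ℝ, ℝ × E) 𝓘(ℝ, ℝ) ω (Prod.fst : ℝ × E → ℝ) z :=
    contDiff_fst.contMDiff.contMDiffAt
  exact ContMDiffAt.comp z (g := fun z : ℝ × X => φ z.1 z.2)
    (f := fun z : ℝ × E => (z.1, (extChartAt 𝓘(ℝ, E) x₀).symm z.2))
    (contMDiffAt_flow hφ ht _) (h3.prodMk (h1.comp z h2))

theorem isOpen_flowDomain (hφ : IsAnalyticFamily ε φ) (x₀ y₀ : X) :
    IsOpen (flowDomain ε φ x₀ y₀) := by
  rw [isOpen_iff_mem_nhds]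
  rintro z ⟨h1, h2, h3⟩
  refine Filter.inter_mem (continuous_fst.continuousAt.preimage_mem_nhds (isOpen_Ioo.mem_nhds h1))
    (Filter.inter_mem (continuous_snd.continuousAt.preimage_mem_nhds
      ((isOpen_extChartAt_target x₀).mem_nhds h2)) ?_)
  exact (contMDiffAt_flow_symm hφ h1 h2).continuousAt.preimage_mem_nhds
    ((isOpen_extChartAt_source y₀).mem_nhds h3)

theorem analyticAt_localFlow [CompleteSpace E] (hφ : IsAnalyticFamily ε φ) {x₀ y₀ : X} {z : ℝ × E}
    (hz : z ∈ flowDomain ε φ x₀ y₀) :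
    AnalyticAt ℝ (localFlow φ x₀ y₀) z := by
  have h : ContMDiffAt 𝓘(ℝ, ℝ × E) 𝓘(ℝ, E) ω (localFlow φ x₀ y₀) z :=
    ContMDiffAt.comp z (g := extChartAt 𝓘(ℝ, E) y₀)
      (contMDiffAt_extChartAt' (by rw [← extChartAt_source 𝓘(ℝ, E)]; exact hz.2.2))
      (contMDiffAt_flow_symm hφ hz.1 hz.2.1)
  exact (contMDiffAt_iff_contDiffAt.1 h).analyticAt

theorem spaceDeriv_localFlow [CompleteSpace E] (hφ : IsAnalyticFamily ε φ) {x₀ y₀ : X} {z : ℝ × E}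
    (hz : z ∈ flowDomain ε φ x₀ y₀) :
    spaceDeriv (localFlow φ x₀ y₀) z = fderiv ℝ (fun y => extChartAt 𝓘(ℝ, E) y₀
      (φ z.1 ((extChartAt 𝓘(ℝ, E) x₀).symm y))) z.2 :=
  (fderiv_slice (analyticAt_localFlow hφ hz).differentiableAt).symm

theorem isInvertible_spaceDeriv_localFlow [CompleteSpace E] (hφ : IsAnalyticFamily ε φ)
    {x₀ y₀ : X} {z : ℝ × E} (hz : z ∈ flowDomain ε φ x₀ y₀) :
    (spaceDeriv (localFlow φ x₀ y₀) z).IsInvertible := by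
  rw [spaceDeriv_localFlow hφ hz,
    fderiv_chart_comp hz.2.1 ((φ z.1).mdifferentiable (by simp) _) hz.2.2]
  exact (isInvertible_chartDeriv hz.2.2).comp
    ((isInvertible_mapDeriv _ _).comp (isInvertible_chartSymmDeriv hz.2.1))

/-- In coordinates, the time derivative of the flow is the velocity field along the flow. -/
theorem timePartial_localFlow [CompleteSpace E] (hφ : IsAnalyticFamily ε φ) {x₀ y₀ : X} {z : ℝ × E}
    (hz : z ∈ flowDomain ε φ x₀ y₀) :
    timePartial (localFlow φ x₀ y₀) z =
      vectorInChart y₀ (velocity φ z.1) (localFlow φ x₀ y₀ z) := by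
  set x := (extChartAt 𝓘(ℝ, E) x₀).symm z.2 with hx
  have h1 := mdifferentiableAt_orbit hφ hz.1 x
  have h2 := mfderiv_comp z.1 (g := extChartAt 𝓘(ℝ, E) y₀)
    (mdifferentiableAt_extChartAt_of_mem hz.2.2) h1
  have h3 := (hasDerivAt_slice (analyticAt_localFlow hφ hz).differentiableAt).deriv
  have h4 : deriv (fun s => localFlow φ x₀ y₀ (s, z.2)) z.1 =
      chartDeriv y₀ (φ z.1 x) (vectorAt (velocity φ z.1) (φ z.1 x)) := by
    rw [vectorAt, velocity_apply, ← fderiv_apply_one_eq_deriv, ← mfderiv_eq_fderiv]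
    exact congrArg (fun T => T (1 : ℝ)) h2
  have h5 : localFlow φ x₀ y₀ z = extChartAt 𝓘(ℝ, E) y₀ (φ z.1 x) := rfl
  have h6 := (extChartAt 𝓘(ℝ, E) y₀).left_inv hz.2.2
  rw [← h3, h4, vectorInChart_apply, inverse_chartSymmDeriv
    (by rw [h5]; exact (extChartAt 𝓘(ℝ, E) y₀).map_source hz.2.2), h5, h6]

/-- The velocity field in the chart at `y₀`, as a function of time and space. -/
def velocityInChart (φ : ℝ → X ≃ₘ^ω⟮𝓘(ℝ, E), 𝓘(ℝ, E)⟯ X) (y₀ : X) (w : ℝ × E) : E :=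
  vectorInChart y₀ (velocity φ w.1) w.2

theorem vectorAt_velocity {y₀ : X} {y : E} (hy : y ∈ (extChartAt 𝓘(ℝ, E) y₀).target) (t : ℝ) :
    vectorAt (velocity φ t) ((extChartAt 𝓘(ℝ, E) y₀).symm y) =
      chartSymmDeriv y₀ y (velocityInChart φ y₀ (t, y)) := by
  rw [velocityInChart, vectorInChart_apply, (isInvertible_chartSymmDeriv hy).self_apply_inverse]

theorem vectorAt_velocity_eq {x₀ x : X} (hx : x ∈ (extChartAt 𝓘(ℝ, E) x₀).source) (t : ℝ) :
    vectorAt (velocity φ t) x = chartSymmDeriv x₀ (extChartAt 𝓘(ℝ, E) x₀ x)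
      (velocityInChart φ x₀ (t, extChartAt 𝓘(ℝ, E) x₀ x)) :=
  (chartSymmDeriv_vectorInChart hx (velocity φ t)).symm

/-- The velocity field is jointly analytic in time and space: it is the composition of the time
derivative of the flow with the local inverse of `(t, y) ↦ (t, φ_t y)`. -/
theorem analyticAt_vectorInChart_velocity [FiniteDimensional ℝ E] (hφ : IsAnalyticFamily ε φ)
    {t : ℝ} (ht : t ∈ Set.Ioo (-ε) ε) (x : X) :
    AnalyticAt ℝ (fun w : ℝ × E => vectorInChart (φ t x) (velocity φ w.1) w.2)
      (t, extChartAt 𝓘(ℝ, E) (φ t x) (φ t x)) := by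
  have : CompleteSpace E := FiniteDimensional.complete ℝ E
  set y₀ := φ t x
  set f := localFlow φ x y₀
  set z₀ : ℝ × E := (t, extChartAt 𝓘(ℝ, E) x x) with hz₀
  have hz : z₀ ∈ flowDomain ε φ x y₀ := self_mem_flowDomain φ ht x
  have hf : AnalyticAt ℝ f z₀ := analyticAt_localFlow hφ hz
  have hF : AnalyticAt ℝ (fun w : ℝ × E => (w.1, f w)) z₀ := analyticAt_fst.prod hf
  obtain ⟨e, he⟩ := isInvertible_spaceDeriv_localFlow hφ hz
  -- the derivative of `(t, y) ↦ (t, f_t y)` is triangular with invertible diagonal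
  have hF' : ∃ e' : (ℝ × E) ≃L[ℝ] (ℝ × E),
      (e' : ℝ × E →L[ℝ] ℝ × E) = (ContinuousLinearMap.fst ℝ ℝ E).prod (fderiv ℝ f z₀) := by
    set L := fderiv ℝ f z₀
    have he1 : ∀ v, e v = L (0, v) := fun v => congrArg (fun T : E →L[ℝ] E => T v) he
    refine ⟨ContinuousLinearEquiv.equivOfInverse ((ContinuousLinearMap.fst ℝ ℝ E).prod L)
      ((ContinuousLinearMap.fst ℝ ℝ E).prod ((e.symm : E →L[ℝ] E) ∘L
        (ContinuousLinearMap.snd ℝ ℝ E -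
          L ∘L ContinuousLinearMap.inl ℝ ℝ E ∘L ContinuousLinearMap.fst ℝ ℝ E))) ?_ ?_, rfl⟩
    · rintro ⟨s, v⟩
      have h : L (s, v) - L (s, 0) = e v := by rw [he1, ← map_sub]; simp
      suffices e.symm (L (s, v)) - e.symm (L (s, 0)) = v by simpa using this
      rw [← map_sub, h, e.symm_apply_apply]
    · rintro ⟨s, v⟩
      have h : L (s, e.symm (v - L (s, 0))) = L (s, 0) + e (e.symm (v - L (s, 0))) := by
        rw [he1, ← map_add]; simp
      simp only [ContinuousLinearMap.prod_apply, ContinuousLinearMap.coe_fst',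
        ContinuousLinearMap.comp_apply, sub_apply, ContinuousLinearMap.coe_snd',
        ContinuousLinearMap.inl_apply, ContinuousLinearEquiv.coe_coe, h,
        ContinuousLinearEquiv.apply_symm_apply, add_sub_cancel]
  obtain ⟨e', he'⟩ := hF'
  have hFd : HasFDerivAt (fun w : ℝ × E => (w.1, f w)) (e' : ℝ × E →L[ℝ] ℝ × E) z₀ := by
    rw [he']
    exact hasFDerivAt_fst.prodMk hf.differentiableAt.hasFDerivAt
  have hFω : ContDiffAt ℝ ω (fun w : ℝ × E => (w.1, f w)) z₀ := hF.contDiffAt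
  set G := hFω.localInverse hFd (by simp) with hG
  have hGan : AnalyticAt ℝ G (z₀.1, f z₀) := (hFω.to_localInverse hFd (by simp)).analyticAt
  have hGz : G (z₀.1, f z₀) = z₀ := hFω.localInverse_apply_image hFd (by simp)
  have hFG : ∀ᶠ w in 𝓝 (z₀.1, f z₀), ((G w).1, f (G w)) = w :=
    (hFω.hasStrictFDerivAt' hFd (by simp)).eventually_right_inverse
  have hGdom : ∀ᶠ w in 𝓝 (z₀.1, f z₀), G w ∈ flowDomain ε φ x y₀ :=
    hGan.continuousAt.preimage_mem_nhds
      (by rw [hGz]; exact (isOpen_flowDomain hφ x y₀).mem_nhds hz)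
  have hfz : f z₀ = extChartAt 𝓘(ℝ, E) y₀ y₀ := localFlow_self φ t x y₀
  rw [← hfz]
  have han : AnalyticAt ℝ (timePartial f ∘ G) (z₀.1, f z₀) :=
    AnalyticAt.comp (by rw [hGz]; exact analyticAt_timePartial hf) hGan
  refine han.congr ?_
  filter_upwards [hFG, hGdom] with w hw hw'
  have h1 : (G w).1 = w.1 := (Prod.ext_iff.1 hw).1
  have h2 : f (G w) = w.2 := (Prod.ext_iff.1 hw).2
  rw [Function.comp_apply, timePartial_localFlow hφ hw', h1]
  exact congrArg _ h2

end LocalFlow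

/-! ### Time derivatives of the pull-back on the manifold -/

section Expansion

theorem iteratedDeriv_clm_apply {G G' : Type*} [NormedAddCommGroup G] [NormedSpace ℝ G]
    [NormedAddCommGroup G'] [NormedSpace ℝ G'] [CompleteSpace G] (L : G →L[ℝ] G') {g : ℝ → G}
    {t : ℝ} (hg : AnalyticAt ℝ g t) (k : ℕ) :
    iteratedDeriv k (fun s => L (g s)) t = L (iteratedDeriv k g t) := by
  have h := L.iteratedFDeriv_comp_left (hg.contDiffAt (n := k)) (i := k) le_rfl
  rw [iteratedDeriv, iteratedDeriv]
  exact congrArg (fun T => T fun _ => 1) h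

theorem analyticAt_slice {E G : Type*} [NormedAddCommGroup E] [NormedSpace ℝ E]
    [NormedAddCommGroup G] [NormedSpace ℝ G] {g : ℝ × E → G} {z : ℝ × E} (hg : AnalyticAt ℝ g z) :
    AnalyticAt ℝ (fun s => g (s, z.2)) z.1 :=
  AnalyticAt.comp (g := g) (f := fun s : ℝ => (s, z.2)) hg (analyticAt_id.prod analyticAt_const)

theorem hasSum_clm_apply {G G' : Type*} [NormedAddCommGroup G] [NormedSpace ℝ G]
    [NormedAddCommGroup G'] [NormedSpace ℝ G'] (L : G →L[ℝ] G') {u : ℕ → G} {g : G}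
    (h : HasSum u g) : HasSum (fun k => L (u k)) (L g) := L.hasSum h

variable {p q : ℕ} {E : Type*} [NormedAddCommGroup E] [NormedSpace ℝ E] [FiniteDimensional ℝ E]

/-- The pull-back by `f` as a continuous linear map. -/
theorem Tensor.exists_pullbackL (p q : ℕ) (f : E →L[ℝ] E) :
    ∃ L : Tensor p q E →L[ℝ] Tensor p q E, ∀ A, L A = Tensor.pullback f A := by
  have := Tensor.finiteDimensional p q E
  let l : Tensor p q E →ₗ[ℝ] Tensor p q E :=
    { toFun := Tensor.pullback f
      map_add' := Tensor.pullback_add f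
      map_smul' := Tensor.pullback_smul f }
  have key : ∀ {Q : Type _} [NormedAddCommGroup Q] [NormedSpace ℝ Q] [FiniteDimensional ℝ Q]
      (l : Q →ₗ[ℝ] Q), ∃ L : Q →L[ℝ] Q, ∀ A, L A = l A :=
    fun l => ⟨LinearMap.toContinuousLinearMap l, fun _ => rfl⟩
  exact key (Q := Tensor p q E) l

variable {X : Type*} [TopologicalSpace X] [ChartedSpace E X] [IsManifold 𝓘(ℝ, E) ω X]
  {ε : ℝ} {φ : ℝ → X ≃ₘ^ω⟮𝓘(ℝ, E), 𝓘(ℝ, E)⟯ X}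

theorem vectorAt_timeDeriv {y₀ : X} {y : E} (hy : y ∈ (extChartAt 𝓘(ℝ, E) y₀).target) {t : ℝ}
    (ha : AnalyticAt ℝ (velocityInChart φ y₀) (t, y)) (m : ℕ) :
    vectorAt (timeDeriv (velocity φ) m t) ((extChartAt 𝓘(ℝ, E) y₀).symm y) =
      chartSymmDeriv y₀ y (iteratedDeriv m (fun s => velocityInChart φ y₀ (s, y)) t) := by
  have : CompleteSpace E := FiniteDimensional.complete ℝ E
  rw [← iteratedDeriv_clm_apply _ (analyticAt_slice ha)]
  simp only [← vectorAt_velocity hy]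
  rfl

theorem vectorInChart_timeDeriv {y₀ : X} {y : E} (hy : y ∈ (extChartAt 𝓘(ℝ, E) y₀).target) {t : ℝ}
    (ha : AnalyticAt ℝ (velocityInChart φ y₀) (t, y)) (m : ℕ) :
    vectorInChart y₀ (timeDeriv (velocity φ) m t) y =
      timePartial^[m] (velocityInChart φ y₀) (t, y) := by
  have : CompleteSpace E := FiniteDimensional.complete ℝ E
  rw [vectorInChart_apply, vectorAt_timeDeriv hy ha,
    (isInvertible_chartSymmDeriv hy).inverse_apply_self]
  exact (iteratedDeriv_slice m ha).2

/-- Iterated Lie derivatives along time derivatives of the velocity field, in coordinates. -/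
theorem tensorInChart_multiLieDeriv {y₀ : X} {W : Set (ℝ × E)} (hW : IsOpen W)
    (hWt : ∀ w ∈ W, w.2 ∈ (extChartAt 𝓘(ℝ, E) y₀).target)
    (hξ : ∀ w ∈ W, AnalyticAt ℝ (velocityInChart φ y₀) w)
    (hξ' : ∀ m, AnalyticOnNhd ℝ (timePartial^[m] (velocityInChart φ y₀)) W)
    {α : TensorField p q E X} (B : analyticFields W (Tensor p q E))
    (hB : ∀ w ∈ W, B.1 w = tensorInChart y₀ α w.2) (l : List ℕ) {t : ℝ} {y : E}
    (hy : (t, y) ∈ W) :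
    tensorInChart y₀ (multiLieDeriv (l.map fun m => timeDeriv (velocity φ) (m - 1) t) α) y =
      ((l.map fun m => lieOps p q hW hξ' (m - 1)).prod B).1 (t, y) := by
  have : CompleteSpace E := FiniteDimensional.complete ℝ E
  induction l generalizing y with
  | nil => exact (hB (t, y) hy).symm
  | cons m l ih =>
    rw [List.map_cons, List.map_cons, List.prod_cons, Module.End.mul_apply]
    generalize (l.map fun m => lieOps p q hW hξ' (m - 1)).prod B = C at ih
    have hWy : ∀ᶠ y' in 𝓝 y, (t, y') ∈ W :=
      (Continuous.prodMk_right t).continuousAt.eventually (hW.mem_nhds hy)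
    have h1 : vectorInChart y₀ (timeDeriv (velocity φ) (m - 1) t) =ᶠ[𝓝 y]
        fun y => timePartial^[m - 1] (velocityInChart φ y₀) (t, y) := by
      filter_upwards [hWy] with y' hy'
      exact vectorInChart_timeDeriv (hWt _ hy') (hξ _ hy') _
    have h2 : tensorInChart y₀ (multiLieDeriv
        (l.map fun m => timeDeriv (velocity φ) (m - 1) t) α) =ᶠ[𝓝 y]
        fun y => C.1 (t, y) := by
      filter_upwards [hWy] with y' hy'
      exact ih hy'
    have hd1 := (hξ' (m - 1) (t, y) hy).differentiableAt
    have hd2 : DifferentiableAt ℝ C.1 (t, y) := (C.2.1 (t, y) hy).differentiableAt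
    have hd1' : DifferentiableAt ℝ (fun y => timePartial^[m - 1] (velocityInChart φ y₀) (t, y))
      y := differentiableAt_slice hd1
    have hd2' : DifferentiableAt ℝ (fun y => C.1 (t, y)) y := differentiableAt_slice hd2
    have h3 := tensorInChart_lieDeriv (hWt (t, y) hy)
      (hd1'.congr_of_eventuallyEq h1) (hd2'.congr_of_eventuallyEq h2)
    refine h3.trans ?_
    rw [flatLieDeriv_congr h1 h2]
    refine (flatLieDeriv_slice hd1 hd2).trans ?_
    simp only [lieOps, spaceLieOp, LinearMap.coe_mk, AddHom.coe_mk, Set.indicator_of_mem hy]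

/-- The coordinate expression of `(t, x) ↦ (φ_t^* α)(x)` in the chart at `x₀`. -/
def pullbackInChart (φ : ℝ → X ≃ₘ^ω⟮𝓘(ℝ, E), 𝓘(ℝ, E)⟯ X) (x₀ y₀ : X) (α : TensorField p q E X) :
    ℝ × E → Tensor p q E :=
  flowPullback (localFlow φ x₀ y₀) fun w => tensorInChart y₀ α w.2

theorem tensorAt_pullback_flow (hφ : IsAnalyticFamily ε φ) {x₀ y₀ x : X} {t : ℝ}
    (hx : x ∈ (extChartAt 𝓘(ℝ, E) x₀).source)
    (hz : (t, extChartAt 𝓘(ℝ, E) x₀ x) ∈ flowDomain ε φ x₀ y₀) (α : TensorField p q E X) :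
    tensorAt (pullback (φ t) α) x =
      Tensor.pullback (chartDeriv x₀ x)
        (pullbackInChart φ x₀ y₀ α (t, extChartAt 𝓘(ℝ, E) x₀ x)) := by
  have : CompleteSpace E := FiniteDimensional.complete ℝ E
  have hxy := (extChartAt 𝓘(ℝ, E) x₀).left_inv hx
  have h3 : φ t x ∈ (extChartAt 𝓘(ℝ, E) y₀).source := by
    have := hz.2.2
    simpa only [hxy] using this
  rw [tensorAt_pullback hx ((φ t).mdifferentiable (by simp) x) (isInvertible_mapDeriv _ _) h3,
    pullbackInChart, flowPullback, spaceDeriv_localFlow hφ hz]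
  simp only [localFlow, hxy]

theorem analyticAt_pullbackInChart (hφ : IsAnalyticFamily ε φ) {x₀ y₀ : X} {z : ℝ × E}
    (hz : z ∈ flowDomain ε φ x₀ y₀) {α : TensorField p q E X} (hα : IsAnalytic α) :
    AnalyticAt ℝ (pullbackInChart φ x₀ y₀ α) z := by
  have : CompleteSpace E := FiniteDimensional.complete ℝ E
  refine analyticAt_flowPullback (analyticAt_localFlow hφ hz)
    (isInvertible_spaceDeriv_localFlow hφ hz) ?_
  exact AnalyticAt.comp (g := tensorInChart y₀ α) (f := Prod.snd)
    (hα y₀ _ ((extChartAt 𝓘(ℝ, E) y₀).map_source hz.2.2)) analyticAt_snd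

/-- The formula for the time derivatives of `φ_t^* α`. -/
theorem iteratedDeriv_tensorAt_pullback (hφ : IsAnalyticFamily ε φ) {α : TensorField p q E X}
    (hα : IsAnalytic α) (k : ℕ) {t : ℝ} (ht : t ∈ Set.Ioo (-ε) ε) (x : X) :
    iteratedDeriv k (fun s => tensorAt (pullback (φ s) α) x) t =
      ∑ c : Composition k, compCoeff c •
        tensorAt (pullback (φ t) (multiLieDeriv
          (c.blocks.map fun m => timeDeriv (velocity φ) (m - 1) t) α)) x := by
  have : CompleteSpace E := FiniteDimensional.complete ℝ E
  set y₀ := φ t x with hy₀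
  set ξ := velocityInChart φ y₀ with hξdef
  set f := localFlow φ x y₀ with hf
  set z₀ : ℝ × E := (t, extChartAt 𝓘(ℝ, E) x x) with hz₀
  have hz : z₀ ∈ flowDomain ε φ x y₀ := self_mem_flowDomain φ ht x
  have hfz : f z₀ = extChartAt 𝓘(ℝ, E) y₀ y₀ := localFlow_self φ t x y₀
  have hxs : x ∈ (extChartAt 𝓘(ℝ, E) x).source := mem_extChartAt_source x
  -- the domains on which all coordinate expressions are analytic
  set W : Set (ℝ × E) := {w | AnalyticAt ℝ ξ w} ∩ Prod.snd ⁻¹' (extChartAt 𝓘(ℝ, E) y₀).target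
    with hWdef
  have hW : IsOpen W := (isOpen_analyticAt ℝ ξ).inter
    ((isOpen_extChartAt_target y₀).preimage continuous_snd)
  have hξ' : ∀ m, AnalyticOnNhd ℝ (timePartial^[m] ξ) W :=
    fun m w hw => (iteratedDeriv_slice m hw.1).1
  set V : Set (ℝ × E) := flowDomain ε φ x y₀ ∩ (fun z => (z.1, f z)) ⁻¹' W with hVdef
  have hV : IsOpen V := by
    refine ContinuousOn.isOpen_inter_preimage (fun z hz => ?_) (isOpen_flowDomain hφ x y₀) hW
    exact (continuousAt_fst.prodMk
      (analyticAt_localFlow hφ hz).continuousAt).continuousWithinAt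
  have hzV : z₀ ∈ V := by
    refine ⟨hz, ?_, ?_⟩
    · change AnalyticAt ℝ ξ (t, f z₀)
      rw [hfz]
      exact analyticAt_vectorInChart_velocity hφ ht x
    · change f z₀ ∈ (extChartAt 𝓘(ℝ, E) y₀).target
      rw [hfz]
      exact mem_extChartAt_target y₀
  have hBan : AnalyticOnNhd ℝ (fun w : ℝ × E => tensorInChart y₀ α w.2) W := fun w hw =>
    AnalyticAt.comp (g := tensorInChart y₀ α) (f := Prod.snd) (hα y₀ _ hw.2) analyticAt_snd
  set B : analyticFields W (Tensor p q E) :=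
    ⟨W.indicator fun w => tensorInChart y₀ α w.2, indicator_mem_analyticFields hW hBan⟩ with hBdef
  have hB : ∀ w ∈ W, B.1 w = tensorInChart y₀ α w.2 := fun w hw =>
    Set.indicator_of_mem hw (fun w : ℝ × E => tensorInChart y₀ α w.2)
  have hB0 : timePartialOp hW B = 0 := by
    refine Subtype.ext (funext fun w => ?_)
    by_cases hw : w ∈ W
    · have h1 := (hasDerivAt_slice (B.2.1 w hw).differentiableAt).deriv
      have h2 : (fun s => B.1 (s, w.2)) =ᶠ[𝓝 w.1] fun _ => tensorInChart y₀ α w.2 := by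
        filter_upwards [eventually_slice (hW.mem_nhds hw)] with s hs using hB _ hs
      rw [h2.deriv_eq, deriv_const] at h1
      simp only [timePartialOp, LinearMap.coe_mk, AddHom.coe_mk, Set.indicator_of_mem hw]
      exact h1.symm
    · simp only [timePartialOp, LinearMap.coe_mk, AddHom.coe_mk, Set.indicator_of_notMem hw]
      rfl
  -- pass to coordinates and apply the flat formula
  obtain ⟨K, hK⟩ := Tensor.exists_pullbackL p q (chartDeriv (E := E) x x)
  have hev : (fun s => tensorAt (pullback (φ s) α) x) =ᶠ[𝓝 t]
      fun s => K (flowPullback f B.1 (s, z₀.2)) := by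
    have hzV' : ∀ᶠ s in 𝓝 t, (s, z₀.2) ∈ V := eventually_slice (z := z₀) (hV.mem_nhds hzV)
    filter_upwards [hzV'] with s hs
    rw [tensorAt_pullback_flow hφ hxs hs.1, hK, pullbackInChart, flowPullback, flowPullback,
      hB _ hs.2]
  have han : AnalyticAt ℝ (flowPullback f B.1) z₀ :=
    analyticAt_flowPullback (analyticAt_localFlow hφ hz) (isInvertible_spaceDeriv_localFlow hφ hz)
      (B.2.1 _ hzV.2)
  have hmain := iteratedDeriv_flowPullback hW (ξ := ξ) (hξ' 0) hV
    (fun z hz => analyticAt_localFlow hφ hz.1)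
    (fun z hz => isInvertible_spaceDeriv_localFlow hφ hz.1) (fun z hz => hz.2)
    (fun z hz => timePartial_localFlow hφ hz.1) B k hzV
  have := Tensor.finiteDimensional p q E
  rw [hev.iteratedDeriv_eq k]
  have h3 := iteratedDeriv_clm_apply K (analyticAt_slice han) k
  refine h3.trans ?_
  rw [hmain, timeLieOp_pow_apply hW hξ' B hB0 k]
  obtain ⟨K', hK'⟩ := Tensor.exists_pullbackL p q (spaceDeriv f z₀)
  rw [flowPullback, ← hK', compositionSum]
  have hsum : ((∑ c : Composition k, compCoeff c •
      (c.blocks.map fun m => lieOps p q hW hξ' (m - 1)).prod) B).1 (z₀.1, f z₀) =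
      ∑ c : Composition k, compCoeff c • tensorInChart y₀ (multiLieDeriv
          (c.blocks.map fun m => timeDeriv (velocity φ) (m - 1) t) α) (f z₀) := by
    rw [LinearMap.sum_apply, Submodule.coe_sum, Finset.sum_apply]
    refine Finset.sum_congr rfl fun c _ => ?_
    have h := tensorInChart_multiLieDeriv hW (fun w hw => hw.2) (fun w hw => hw.1) hξ' B hB
      c.blocks hzV.2
    rw [LinearMap.smul_apply, Submodule.coe_smul, Pi.smul_apply]
    exact congrArg (fun T => compCoeff c • T) h.symm
  rw [hsum, map_sum, map_sum]
  refine Finset.sum_congr rfl fun c _ => ?_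
  rw [map_smul, map_smul, tensorAt_pullback_flow hφ hxs hz, hK, hK']
  rfl

end Expansion

/-! ### Analyticity and Taylor expansions -/

section TaylorExpansion

variable {p q : ℕ} {E : Type*} [NormedAddCommGroup E] [NormedSpace ℝ E] [FiniteDimensional ℝ E]
  {X : Type*} [TopologicalSpace X] [ChartedSpace E X] [IsManifold 𝓘(ℝ, E) ω X]
  {ε : ℝ} {φ : ℝ → X ≃ₘ^ω⟮𝓘(ℝ, E), 𝓘(ℝ, E)⟯ X}

theorem analyticAt_velocityInChart (hφ : IsAnalyticFamily ε φ) {t : ℝ} (ht : t ∈ Set.Ioo (-ε) ε)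
    (x : X) : AnalyticAt ℝ (velocityInChart φ x) (t, extChartAt 𝓘(ℝ, E) x x) := by
  obtain ⟨x', rfl⟩ := (φ t).surjective x
  exact analyticAt_vectorInChart_velocity hφ ht x'

theorem analyticAt_velocity (hφ : IsAnalyticFamily ε φ) {t : ℝ} (ht : t ∈ Set.Ioo (-ε) ε) (x : X) :
    AnalyticAt ℝ (fun s => vectorAt (velocity φ s) x) t := by
  simp only [vectorAt_velocity_eq (mem_extChartAt_source (I := 𝓘(ℝ, E)) x)]
  exact AnalyticAt.comp (g := chartSymmDeriv x (extChartAt 𝓘(ℝ, E) x x))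
    (ContinuousLinearMap.analyticAt _ _) (analyticAt_slice (analyticAt_velocityInChart hφ ht x))

/-- The Taylor expansion of the velocity field in time. -/
theorem eventually_hasSum_velocity (hφ : IsAnalyticFamily ε φ) (hε : 0 < ε) (x₀ : X) :
    ∀ᶠ z : ℝ × X in 𝓝 ((0 : ℝ), x₀),
      HasSum (fun k : ℕ => z.1 ^ k • vectorAt (timeCoeff (velocity φ) k) z.2)
        (vectorAt (velocity φ z.1) z.2) := by
  have : CompleteSpace E := FiniteDimensional.complete ℝ E
  have ha := analyticAt_velocityInChart hφ (t := 0) ⟨by simpa using hε, hε⟩ x₀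
  filter_upwards [eventually_of_chart
    ((eventually_hasSum_iteratedDeriv ha).and ha.eventually_analyticAt)] with z hz
  obtain ⟨hzs, ⟨hsum, -⟩, ⟨-, han⟩⟩ := hz
  have h := hasSum_clm_apply (chartSymmDeriv x₀ (extChartAt 𝓘(ℝ, E) x₀ z.2)) hsum
  rw [← vectorAt_velocity_eq hzs] at h
  convert! h using 2 with k
  have hd := vectorAt_timeDeriv ((extChartAt 𝓘(ℝ, E) x₀).map_source hzs) han k
  rw [(extChartAt 𝓘(ℝ, E) x₀).left_inv hzs] at hd
  rw [map_smul, map_smul, ← hd]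
  rfl

/-- Time derivatives of `φ_t^* α` can be computed in a chart; `K` is the pull-back by the chart. -/
theorem analyticAt_tensorAt_pullback (hφ : IsAnalyticFamily ε φ) {α : TensorField p q E X}
    (hα : IsAnalytic α) {x₀ y₀ x : X} {t : ℝ} (hx : x ∈ (extChartAt 𝓘(ℝ, E) x₀).source)
    (hz : (t, extChartAt 𝓘(ℝ, E) x₀ x) ∈ flowDomain ε φ x₀ y₀) {K : Tensor p q E →L[ℝ] Tensor p q E}
    (hK : ∀ A, K A = Tensor.pullback (chartDeriv x₀ x) A) :
    AnalyticAt ℝ (fun s => tensorAt (pullback (φ s) α) x) t ∧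
      ∀ k, iteratedDeriv k (fun s => tensorAt (pullback (φ s) α) x) t =
        K (iteratedDeriv k
          (fun s => pullbackInChart φ x₀ y₀ α (s, extChartAt 𝓘(ℝ, E) x₀ x)) t) := by
  have := Tensor.finiteDimensional p q E
  have hev : (fun s => tensorAt (pullback (φ s) α) x) =ᶠ[𝓝 t]
      fun s => K (pullbackInChart φ x₀ y₀ α (s, extChartAt 𝓘(ℝ, E) x₀ x)) := by
    filter_upwards [eventually_slice (z := (t, extChartAt 𝓘(ℝ, E) x₀ x))
      ((isOpen_flowDomain hφ x₀ y₀).mem_nhds hz)] with s hs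
    rw [tensorAt_pullback_flow hφ hx hs, hK]
  have han := analyticAt_slice (analyticAt_pullbackInChart hφ hz hα)
  refine ⟨?_, fun k => ?_⟩
  · exact (AnalyticAt.comp (g := K) (ContinuousLinearMap.analyticAt _ _) han).congr hev.symm
  · rw [hev.iteratedDeriv_eq k]
    exact iteratedDeriv_clm_apply K han k

/-- The Taylor expansion of `φ_t^* α` in time, in terms of its derivatives at `t = 0`. -/
theorem eventually_hasSum_pullback (hφ : IsAnalyticFamily ε φ) (hε : 0 < ε)
    {α : TensorField p q E X} (hα : IsAnalytic α) (x₀ : X) :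
    ∀ᶠ z : ℝ × X in 𝓝 ((0 : ℝ), x₀),
      HasSum (fun k : ℕ => z.1 ^ k • ((k.factorial : ℝ)⁻¹ •
        iteratedDeriv k (fun s => tensorAt (pullback (φ s) α) z.2) 0))
        (tensorAt (pullback (φ z.1) α) z.2) := by
  have hz₀ := self_mem_flowDomain φ (t := 0) (ε := ε) ⟨by simpa using hε, hε⟩ x₀
  have ha := analyticAt_pullbackInChart hφ hz₀ hα
  filter_upwards [eventually_of_chart ((eventually_hasSum_iteratedDeriv ha).and
    ((isOpen_flowDomain hφ x₀ (φ 0 x₀)).mem_nhds hz₀))] with z hz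
  obtain ⟨hzs, ⟨hsum, hzd⟩, ⟨-, hz0⟩⟩ := hz
  obtain ⟨K, hK⟩ := Tensor.exists_pullbackL p q (chartDeriv (E := E) x₀ z.2)
  have h := hasSum_clm_apply K hsum
  rw [hK, ← tensorAt_pullback_flow hφ hzs hzd] at h
  convert! h using 2 with k
  rw [map_smul, map_smul, (analyticAt_tensorAt_pullback hφ hα hzs hz0 hK).2 k]

/-- The expansion of `φ_t^* α` at `t = 0` in normalized iterated Lie derivatives. -/
theorem eventually_hasSum_multiLieDeriv (hφ : IsAnalyticFamily ε φ) (hε : 0 < ε)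
    (hφ0 : ∀ x, φ 0 x = x) {α : TensorField p q E X} (hα : IsAnalytic α) (x₀ : X) :
    ∀ᶠ z : ℝ × X in 𝓝 ((0 : ℝ), x₀),
      HasSum (fun k : ℕ => z.1 ^ (k + 1) • ∑ c : Composition (k + 1), tensorAt (multiLieDeriv
          (List.ofFn fun j : Fin c.length => ((c.sizeUpTo (j + 1) : ℝ)⁻¹) •
            timeCoeff (velocity φ) (c.blocksFun j - 1)) α) z.2)
        (tensorAt (pullback (φ z.1) α) z.2 - tensorAt α z.2) := by
  filter_upwards [eventually_hasSum_pullback hφ hε hα x₀] with z hz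
  have h := (hasSum_nat_add_iff' 1).2 hz
  have h0 : ∀ β : TensorField p q E X, pullback (φ 0) β = β := pullback_of_eq_id hφ0
  rw [Finset.sum_range_one, pow_zero, one_smul, Nat.factorial_zero, Nat.cast_one, inv_one,
    one_smul, iteratedDeriv_zero, h0] at h
  refine (congrArg (fun u : ℕ → Tensor p q E => HasSum u _) (funext fun k => ?_)).mp h
  rw [iteratedDeriv_tensorAt_pullback hφ hα (k + 1) ⟨by simpa using hε, hε⟩, Finset.smul_sum]
  refine congrArg (fun T : Tensor p q E => z.1 ^ (k + 1) • T)
    (Finset.sum_congr rfl fun c _ => ?_)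
  rw [h0, multiLieDeriv_timeCoeff, smul_smul]
  rfl

end TaylorExpansion

end LieExpansion

end

theorem mainTheorem3 {E : Type*} [NormedAddCommGroup E] [NormedSpace ℝ E] [FiniteDimensional ℝ E]
    {X : Type*} [TopologicalSpace X] [ChartedSpace E X] [IsManifold 𝓘(ℝ, E) ω X]
    (p q : ℕ) (ε : ℝ) (hε : 0 < ε)
    (φ : ℝ → X ≃ₘ^ω⟮𝓘(ℝ, E), 𝓘(ℝ, E)⟯ X)
    (hφ : ContMDiffOn (𝓘(ℝ, ℝ).prod 𝓘(ℝ, E)) 𝓘(ℝ, E) ω (fun z : ℝ × X => φ z.1 z.2)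
      (Set.Ioo (-ε) ε ×ˢ Set.univ))
    (hφ0 : ∀ x, φ 0 x = x) :
    -- the vector fields `ξ_t` are analytic in `t`, with expansion `ξ_t = ∑ ξ_k t^k` near `t = 0`
    (∀ x : X, AnalyticOnNhd ℝ (E := ℝ) (F := E)
      (fun t => LieExpansion.velocity φ t x) (Set.Ioo (-ε) ε)) ∧
    (∀ x₀ : X, ∀ᶠ z : ℝ × X in 𝓝 ((0 : ℝ), x₀),
      HasSum (fun k : ℕ => z.1 ^ k • LieExpansion.timeCoeff (LieExpansion.velocity φ) k z.2)
        (LieExpansion.velocity φ z.1 z.2)) ∧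
    ∀ α : LieExpansion.TensorField p q E X, LieExpansion.IsAnalytic α →
      -- the expansion of `φ_t^* α` at `t = 0`, with a radius that is locally uniform in `x`
      (∀ x₀ : X, ∀ᶠ z : ℝ × X in 𝓝 ((0 : ℝ), x₀),
        HasSum
          (fun k : ℕ => z.1 ^ (k + 1) • ∑ c : Composition (k + 1),
            LieExpansion.multiLieDeriv
              (List.ofFn fun j : Fin c.length =>
                ((c.sizeUpTo (j + 1) : ℝ)⁻¹) •
                  LieExpansion.timeCoeff (LieExpansion.velocity φ) (c.blocksFun j - 1)) α z.2)
          (LieExpansion.pullback (φ z.1) α z.2 - α z.2)) ∧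
      -- the formula for the derivatives at every time `t`
      (∀ x : X, AnalyticOnNhd ℝ (E := ℝ) (F := LieExpansion.Tensor p q E)
        (fun t => LieExpansion.pullback (φ t) α x) (Set.Ioo (-ε) ε)) ∧
      (∀ k : ℕ, 1 ≤ k → ∀ t ∈ Set.Ioo (-ε) ε, ∀ x : X,
        iteratedDeriv (F := LieExpansion.Tensor p q E) k
            (fun s => LieExpansion.pullback (φ s) α x) t =
          ∑ c : Composition k, LieExpansion.compCoeff c •
            LieExpansion.pullback (φ t)
              (LieExpansion.multiLieDeriv
                (List.ofFn fun j : Fin c.length =>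
                  LieExpansion.timeDeriv (LieExpansion.velocity φ) (c.blocksFun j - 1) t) α) x) := by
  have hφ' : LieExpansion.IsAnalyticFamily ε φ := hφ
  refine ⟨fun x t ht => LieExpansion.analyticAt_velocity hφ' ht x,
    LieExpansion.eventually_hasSum_velocity hφ' hε, fun α hα =>
      ⟨LieExpansion.eventually_hasSum_multiLieDeriv hφ' hε hφ0 hα, fun x t ht => ?_,
        fun k _ t ht x => ?_⟩⟩
  · obtain ⟨K, hK⟩ := LieExpansion.Tensor.exists_pullbackL p q
      (LieExpansion.chartDeriv (E := E) x x)
    exact (LieExpansion.analyticAt_tensorAt_pullback hφ' hα (mem_extChartAt_source x)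
      (LieExpansion.self_mem_flowDomain φ ht x) hK).1
  · refine (LieExpansion.iteratedDeriv_tensorAt_pullback hφ' hα k ht x).trans
      (Finset.sum_congr rfl fun c _ => ?_)
    rw [← LieExpansion.ofFn_blocksFun_map c fun m =>
      LieExpansion.timeDeriv (LieExpansion.velocity φ) (m - 1) t]
    rfl
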